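/- Consider a single-antenna base station and a single-antenna receiver that are connected only through a passive RIS with $N\ge 1$ elements. Let $g_b,g_d\in\mathbb C^N$ be the channel vectors from the base station to the RIS and from the RIS to the receiver. Their $2N$ entries are independent; the magnitudes of the entries of $g_b$ have the Nakagami law with shape $m_b>0$ and average power $\Omega_b>0$, those of $g_d$ the Nakagami law with shape $m_d>0$ and average power $\Omega_d>0$. Let $\Phi=\mathrm{diag}(e^{j\phi_1},\dots,e^{j\phi_N})$, with phases $\phi_n\in(0,2\pi]$ that may depend on the channels and align all reflected paths, so that $D:=|g_d^H\Phi g_b|=\sum_n|g_{b,n}||g_{d,n}|$. Let $P_b>0$ be the transmit power, $0<\alpha\le 1$ the reflection factor, $\sigma_r^2>0$ the thermal noise variance per RIS element, $\sigma_d^2>0$ the receiver noise variance, $\rho=P_b/\sigma_d^2$, $\lambda=\alpha\sigma_r^2/\sigma_d^2$, $\psi=\rho\alpha$, $Y:=|g_d^H\Phi|^2$, and $\Upsilon=2^{\mathfrak R/B}-1$ with target rate $\mathfrak R>0$ and bandwidth $B>0$. The SINR is $\gamma=\psi D^2/(\lambda Y+1)$; put $$\gamma^{UB}=\min\Big(\frac{\psi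 D^2}{\lambda Y},\ \psi D^2\Big),\qquad \gamma^{LB}=\tfrac12\gamma^{UB}$$ (when $Y=0$, and hence $D=0$, the first entry of the minimum is read as $0$). (a) $\gamma^{LB}\le\gamma\le\gamma^{UB}$, hence $\Pr(\gamma^{UB}<\Upsilon)\le\Pr(\gamma<\Upsilon)\le\Pr(\gamma^{LB}<\Upsilon)=\Pr(\gamma^{UB}<2\Upsilon)$. (b) Put $r=\frac{\Gamma(m_b+1/2)\Gamma(m_d+1/2)}{\Gamma(m_b)\Gamma(m_d)}$. Then $D$ is square-integrable with mean and variance $$\mu=N r\sqrt{\frac{\Omega_b\Omega_d}{m_bm_d}}>0,\qquad \sigma^2=N\Omega_b\Omega_d\Big[1-\frac{r^2}{m_bm_d}\Big]>0,$$ so that the Gamma law with the same mean and variance as $D$ has shape $\delta=\mu^2/\sigma^2$ and scale $\zeta=\sigma^2/\mu$; and $Y$ has the Gamma law with shape $m_dN$ and rate $m_d/\Omega_d$. The approximate model with shape $\kappa>0$ is the following. In the first branch $\psi D^2/(\lambda Y)$, $D$ is replaced by a Gamma variable with shape $\kappa$ and scale $\zeta$, independent of $Y$; in the second branch $\psi D^2$,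 $D$ is replaced by a Gamma variable with shape $\delta$ and scale $\zeta$; and the two branches are taken to be independent. In this model let $P^{LB}_\kappa(\Upsilon)$ be the probability that the minimum of the two branches is $<\Upsilon$, and $P^{UB}_\kappa(\Upsilon)$ the probability that half this minimum is $<\Upsilon$. (c) For every integer $k\ge 1$ (the positive integer value used in place of $\delta$ in the first branch, $k=\delta$ when $\delta$ is an integer), $$P^{LB}_k(\Upsilon)=1-(1-\xi_1(\Upsilon))(1-\xi_2(\Upsilon)),\qquad P^{UB}_k(\Upsilon)=1-(1-\xi_1(2\Upsilon))(1-\xi_2(2\Upsilon)),$$ where, for $\upsilon\in\{\Upsilon,2\Upsilon\}$, $\xi_1(\upsilon)$ and $\xi_2(\upsilon)$ are the probabilities in the model that the first and the second branch are $<\upsilon$, and $$\xi_1(\upsilon)=1-\sum_{p=0}^{k-1}\frac{1}{p!\sqrt\pi}\Big(\frac{m_d}{\Omega_d}\Big)^{-p/2}\Big(\frac1\zeta\sqrt{\frac{\upsilon\lambda}{\psi}}\Big)^p\frac{1}{\Gamma(m_dN)}\,G^{2,1}_{1,2}\Big(\frac{\lambda\Omega_d\upsilon}{4\psi m_d\zeta^2}\,\Big|\,\begin{matrix}1-m_dN-\frac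 p2\\ 0,\ \frac12\end{matrix}\Big),$$ $$\xi_2(\upsilon)=\frac{1}{\Gamma(\delta)}\,G^{1,1}_{1,2}\Big(\frac1\zeta\sqrt{\frac{\upsilon}{\psi}}\,\Big|\,\begin{matrix}1\\ \delta,\ 0\end{matrix}\Big).$$ Here $G^{m,n}_{p,q}$ is the Meijer function, given by its Mellin--Barnes integral along a vertical line separating the two families of poles; for the parameters above such lines exist, the integral converges absolutely on each of them, and its value does not depend on the line. (d) With the matched real shape $\kappa=\delta$, the two formulas in (c) hold with $\xi_2$ as above and with $\xi_1(\upsilon)=\int_0^\infty f_Y(y)\,F_X(\lambda\upsilon y/\psi)\,dy$, a convergent integral, where $f_Y$ is the density of $Y$ and $F_X(x)=\frac{1}{\Gamma(\delta)}\int_0^{\sqrt x/\zeta}t^{\delta-1}e^{-t}\,dt$. -/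

import Mathlib

open MeasureTheory ProbabilityTheory

noncomputable section

/-! ### Special functions -/

/-- The integrand of the Mellin--Barnes integral of the Meijer function `G^{m,n}_{p,q}(z | a ; b)`:
`∏_{j ≤ m} Γ(b_j - s) ∏_{j ≤ n} Γ(1 - a_j + s) / (∏_{j > m} Γ(1 - b_j + s) ∏_{j > n} Γ(a_j - s)) z^s`. -/
def meijerIntegrand (m n : ℕ) {p q : ℕ} (a : Fin p → ℂ) (b : Fin q → ℂ) (z s : ℂ) : ℂ :=
  (∏ j : Fin q, if (j : ℕ) < m then Complex.Gamma (b j - s)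
      else (Complex.Gamma (1 - b j + s))⁻¹) *
  (∏ j : Fin p, if (j : ℕ) < n then Complex.Gamma (1 - a j + s)
      else (Complex.Gamma (a j - s))⁻¹) * z ^ s

/-- The vertical line `Re s = c` has all poles of `Γ(b_j - s)`, `j ≤ m`, on its right and all poles
of `Γ(1 - a_j + s)`, `j ≤ n`, on its left. -/
def IsMeijerLine (m n : ℕ) {p q : ℕ} (a : Fin p → ℂ) (b : Fin q → ℂ) (c : ℝ) : Prop :=
  (∀ j : Fin q, (j : ℕ) < m → c < (b j).re) ∧ (∀ j : Fin p, (j : ℕ) < n → (a j).re - 1 < c)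

/-- `(1 / 2πi) ∫ ... ds` along the upward vertical line `Re s = c`. -/
def meijerLineIntegral (m n : ℕ) {p q : ℕ} (a : Fin p → ℂ) (b : Fin q → ℂ) (z : ℂ) (c : ℝ) : ℂ :=
  1 / (2 * (Real.pi : ℂ)) * ∫ t : ℝ, meijerIntegrand m n a b z ((c : ℂ) + (t : ℂ) * Complex.I)

open Classical in
/-- The Meijer function `G^{m,n}_{p,q}(z | a ; b)`, for parameters whose two families of poles can be
separated by a vertical line. -/
def meijerG (m n : ℕ) {p q : ℕ} (a : Fin p → ℂ) (b : Fin q → ℂ) (z : ℂ) : ℂ :=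
  if h : ∃ c, IsMeijerLine m n a b c then meijerLineIntegral m n a b z h.choose else 0

/-- The contour integral that defines the Meijer function makes sense: there is a separating line, the
integral converges absolutely on every such line, and its value does not depend on the line. -/
def MeijerGWellDefined (m n : ℕ) {p q : ℕ} (a : Fin p → ℂ) (b : Fin q → ℂ) (z : ℂ) : Prop :=
  (∃ c, IsMeijerLine m n a b c) ∧
  ∀ c, IsMeijerLine m n a b c →
    Integrable (fun t : ℝ => meijerIntegrand m n a b z ((c : ℂ) + (t : ℂ) * Complex.I)) ∧
    meijerLineIntegral m n a b z c = meijerG m n a b z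

/-- The lower incomplete gamma function `γ(s, x) = ∫_0^x t^(s-1) e^(-t) dt`. -/
def lowerGamma (s x : ℝ) : ℝ := ∫ t in Set.Ioc 0 x, t ^ (s - 1) * Real.exp (-t)

/-! ### Nakagami fading -/

/-- Density of the Nakagami law with shape `m` and average power `w`. -/
def nakagamiPDFReal (m w x : ℝ) : ℝ :=
  if 0 < x then
    2 * m ^ m / (Real.Gamma m * w ^ m) * x ^ (2 * m - 1) * Real.exp (-(m / w) * x ^ 2)
  else 0

/-- The Nakagami law with shape `m` and average power `w`. -/
def nakagamiMeasure (m w : ℝ) : Measure ℝ :=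
  volume.withDensity fun x => ENNReal.ofReal (nakagamiPDFReal m w x)

/-! ### The link -/

/-- The numerical parameters of the link base station -- RIS -- receiver. -/
structure RISParams where
  /-- number of reflecting elements -/
  N : ℕ
  /-- Nakagami shape, base station to RIS -/
  mb : ℝ
  /-- average power, base station to RIS -/
  wb : ℝ
  /-- Nakagami shape, RIS to receiver -/
  md : ℝ
  /-- average power, RIS to receiver -/
  wd : ℝ
  /-- transmit power -/
  Pb : ℝ
  /-- reflection factor -/
  α : ℝ
  /-- variance of the thermal noise of one RIS element -/
  σr2 : ℝ
  /-- variance of the receiver noise -/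
  σd2 : ℝ

namespace RISParams

variable (S : RISParams)

/-- The admissible parameter values. -/
def Valid : Prop :=
  0 < S.N ∧ 0 < S.mb ∧ 0 < S.wb ∧ 0 < S.md ∧ 0 < S.wd ∧ 0 < S.Pb ∧ 0 < S.α ∧ S.α ≤ 1 ∧
    0 < S.σr2 ∧ 0 < S.σd2

/-- The transmit signal-to-noise ratio. -/
def ρ : ℝ := S.Pb / S.σd2

/-- The noise ratio `α σ_r² / σ_d²`. -/
def lam : ℝ := S.α * S.σr2 / S.σd2

def ψ : ℝ := S.ρ * S.α

/-- `Γ(m_b + 1/2) Γ(m_d + 1/2) / (Γ(m_b) Γ(m_d))`. -/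
def gammaRatio : ℝ :=
  Real.Gamma (S.mb + 1 / 2) * Real.Gamma (S.md + 1 / 2) / (Real.Gamma S.mb * Real.Gamma S.md)

/-- Closed form of the mean of the cascaded amplitude. -/
def μD : ℝ := S.gammaRatio * (S.wb * S.wd / (S.mb * S.md)) ^ (1 / 2 : ℝ) * S.N

/-- Closed form of the variance of the cascaded amplitude. -/
def varD : ℝ := S.N * (S.wb * S.wd) * (1 - 1 / (S.mb * S.md) * S.gammaRatio ^ 2)

/-- Shape parameter. -/
def δ : ℝ := S.μD ^ 2 / S.varD

/-- Scale parameter. -/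
def ζ : ℝ := S.varD / S.μD

/-- Top parameter of the Meijer function in the `p`-th summand of `ξ₁`. -/
def topParam₁ (p : ℕ) : Fin 1 → ℂ := ![((1 - S.md * S.N - p / 2 : ℝ) : ℂ)]

/-- Argument of the Meijer function in `ξ₁`. -/
def arg₁ (Υ : ℝ) : ℂ := ((S.lam * S.wd * Υ / (4 * S.ψ * S.md * S.ζ ^ 2) : ℝ) : ℂ)

/-- Argument of the Meijer function in `ξ₂`. -/
def arg₂ (Υ : ℝ) : ℂ := ((1 / S.ζ * √(Υ / S.ψ) : ℝ) : ℂ)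

/-- The closed form `ξ₁`, where `k` is the positive integer used as the shape. -/
def ξ₁ (k : ℕ) (Υ : ℝ) : ℂ :=
  1 - ∑ p ∈ Finset.range k,
    ((1 / ((p.factorial : ℝ) * √Real.pi) * (S.md / S.wd) ^ (-(p : ℝ) / 2) *
        (1 / S.ζ * √(Υ * S.lam / S.ψ)) ^ p * (1 / Real.Gamma (S.md * S.N)) : ℝ) : ℂ) *
      meijerG 2 1 (S.topParam₁ p) ![0, 1 / 2] (S.arg₁ Υ)

/-- The closed form `ξ₂`. -/
def ξ₂ (Υ : ℝ) : ℂ :=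
  ((1 / Real.Gamma S.δ : ℝ) : ℂ) * meijerG 1 1 ![1] ![(S.δ : ℂ), 0] (S.arg₂ Υ)

/-- The density of the law of the noise gain `|g_d^H Φ|²`. -/
def fY (y : ℝ) : ℝ :=
  (S.md / S.wd) ^ (S.md * S.N) * (y ^ (S.md * S.N - 1) / Real.Gamma (S.md * S.N)) *
    Real.exp (-(S.md / S.wd) * y)

/-- The approximate distribution function of the squared cascaded amplitude. -/
def FX (x : ℝ) : ℝ := 1 / Real.Gamma S.δ * lowerGamma S.δ (√x / S.ζ)

/-! Deterministic quantities for given channel vectors `gb`, `gd` and phase shifts `φ`. -/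

/-- The reflection matrix `Φ = diag(e^{jφ_1}, ..., e^{jφ_N})`. -/
def reflection (φ : Fin S.N → ℝ) : Matrix (Fin S.N) (Fin S.N) ℂ :=
  Matrix.diagonal fun n => Complex.exp ((φ n : ℂ) * Complex.I)

/-- `|g_d^H Φ g_b|`. -/
def signalAmp (gb gd : Fin S.N → ℂ) (φ : Fin S.N → ℝ) : ℝ :=
  ‖dotProduct (Matrix.vecMul (star gd) (S.reflection φ)) gb‖

/-- `|g_d^H Φ|²`, the squared Euclidean norm of a row vector. -/
def noiseGain (gd : Fin S.N → ℂ) (φ : Fin S.N → ℝ) : ℝ :=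
  ∑ n, ‖Matrix.vecMul (star gd) (S.reflection φ) n‖ ^ 2

/-- Ideal constructive phase alignment: all the reflected paths have the same phase. -/
def Aligned (gb gd : Fin S.N → ℂ) (φ : Fin S.N → ℝ) : Prop :=
  ∃ θ : ℝ, ∀ n, star (gd n) * Complex.exp ((φ n : ℂ) * Complex.I) * gb n =
    ((‖gd n‖ * ‖gb n‖ : ℝ) : ℂ) * Complex.exp ((θ : ℂ) * Complex.I)

/-- The SINR. -/
def sinr (gb gd : Fin S.N → ℂ) (φ : Fin S.N → ℝ) : ℝ :=
  S.ρ * S.α * S.signalAmp gb gd φ ^ 2 / (S.noiseGain gd φ * S.lam + 1)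

/-- The RIS-noise-limited branch, as a function of the amplitude `d = |g_d^H Φ g_b|` and the noise
gain `y = |g_d^H Φ|²`. -/
def branch₁ (d y : ℝ) : ℝ := S.ρ * S.α * d ^ 2 / (y * S.lam)

/-- The receiver-noise-limited branch, as a function of the amplitude `d = |g_d^H Φ g_b|`. -/
def branch₂ (d : ℝ) : ℝ := S.ρ * S.α * d ^ 2

/-- The upper bound of the SINR. -/
def sinrUB (gb gd : Fin S.N → ℂ) (φ : Fin S.N → ℝ) : ℝ :=
  min (S.branch₁ (S.signalAmp gb gd φ) (S.noiseGain gd φ)) (S.branch₂ (S.signalAmp gb gd φ))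

/-- The lower bound of the SINR. -/
def sinrLB (gb gd : Fin S.N → ℂ) (φ : Fin S.N → ℝ) : ℝ :=
  1 / 2 *
    min (S.branch₁ (S.signalAmp gb gd φ) (S.noiseGain gd φ)) (S.branch₂ (S.signalAmp gb gd φ))

end RISParams

/-- The SINR threshold of the target rate `R` over the bandwidth `B`. -/
def sinrThreshold (R B : ℝ) : ℝ := (2 : ℝ) ^ (R / B) - 1

/-! ### The approximate model

The amplitude `D = |g_d^H Φ g_b|` is replaced by a Gamma variable with the mean and the variance of `D`,
taken independent of the noise gain, and the two branches of the bound are taken independent. -/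

/-- Shape of the Gamma law that has the mean and the variance of `D`. -/
def matchedShape {Ω : Type*} [MeasurableSpace Ω] (P : Measure Ω) (D : Ω → ℝ) : ℝ :=
  (∫ ω, D ω ∂P) ^ 2 / variance D P

/-- Scale of the Gamma law that has the mean and the variance of `D`. -/
def matchedScale {Ω : Type*} [MeasurableSpace Ω] (P : Measure Ω) (D : Ω → ℝ) : ℝ :=
  variance D P / ∫ ω, D ω ∂P

namespace RISParams

variable (S : RISParams)

/-- Approximate law of the first branch: `D` is replaced by an independent Gamma variable with shape
`κ` and the matched scale, and the noise gain `Y` keeps its own law. -/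
def branchLaw₁ {Ω : Type*} [MeasurableSpace Ω] (P : Measure Ω) (D Y : Ω → ℝ) (κ : ℝ) : Measure ℝ :=
  ((gammaMeasure κ (1 / matchedScale P D)).prod (P.map Y)).map fun q => S.branch₁ q.1 q.2

/-- Approximate law of the second branch: `D` is replaced by the matched Gamma variable. -/
def branchLaw₂ {Ω : Type*} [MeasurableSpace Ω] (P : Measure Ω) (D : Ω → ℝ) : Measure ℝ :=
  (gammaMeasure (matchedShape P D) (1 / matchedScale P D)).map fun d => S.branch₂ d

/-- The approximate lower-bound outage probability: the probability that the minimum of the two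
branches, taken independent, is below the threshold `Υ`. -/
def approxOutageLB {Ω : Type*} [MeasurableSpace Ω] (P : Measure Ω) (D Y : Ω → ℝ) (κ Υ : ℝ) : ℝ :=
  ((S.branchLaw₁ P D Y κ).prod (S.branchLaw₂ P D)).real {q | min q.1 q.2 < Υ}

/-- The approximate upper-bound outage probability: the same for half the minimum. -/
def approxOutageUB {Ω : Type*} [MeasurableSpace Ω] (P : Measure Ω) (D Y : Ω → ℝ) (κ Υ : ℝ) : ℝ :=
  ((S.branchLaw₁ P D Y κ).prod (S.branchLaw₂ P D)).real {q | 1 / 2 * min q.1 q.2 < Υ}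

end RISParams

end

/-! ### The Meijer functions of the closed form -/

/-! Everything analytic comes from one representation: `e^(-x)` is the inverse Mellin transform of
`Γ` on any line `Re w = σ > 0` (`exp_neg_eq_integral_Gamma`). Weighting it and exchanging the
integrals (`integral_mul_exp_neg_eq_integral_Gamma`) turns real integrals into Mellin–Barnes
integrals. With weight `u^(δ-1)` on `(0, z]` this gives the lower incomplete gamma function as a
`G^{1,1}_{1,2}`. With weight `u^(A-1) e^(-u)` and exponent `2√(zu)`, the duplication formula gives a
`G^{2,1}_{1,2}`. Every separating line yields the same real integral, so independence of the line
needs no contour shift.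

On the probabilistic side, the square of a Nakagami variable is Gamma distributed
(`map_sq_nakagamiMeasure`). This gives the moments of the magnitudes and, through moment generating
functions, the law of `Y`. The variance of `D` is positive because `Γ(m + 1/2)² < m Γ(m)²`
(`Gamma_add_half_sq_lt`).

In the model, the second branch is a Gamma distribution function evaluated at a square root. The
first is such a function averaged over `Y` (`branchLaw₁_real_Iio`). For integer shape it is a finite
Erlang sum, and each summand averages to a moment of `Y` tilted by `exp (-c √y)`, which is the
`G^{2,1}_{1,2}` above. Independence of the branches gives the product formula.

The bounds on the SINR only use `max 1 x ≤ 1 + x ≤ 2 max 1 x` with `x = λY`. -/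

lemma norm_Gamma_le_Gamma_re {s : ℂ} (hs : 0 < s.re) : ‖Complex.Gamma s‖ ≤ Real.Gamma s.re := by
  rw [Complex.Gamma_eq_integral hs, Real.Gamma_eq_integral hs, Complex.GammaIntegral]
  refine (norm_integral_le_integral_norm _).trans (le_of_eq ?_)
  refine setIntegral_congr_fun measurableSet_Ioi fun x (hx : 0 < x) => ?_
  have h : ‖(x : ℂ) ^ (s - 1)‖ = x ^ (s.re - 1) := by
    rw [Complex.norm_cpow_eq_rpow_re_of_pos hx]; simp
  simp only [norm_mul, h, Complex.norm_real, Real.norm_eq_abs, Real.abs_exp]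

lemma continuous_Gamma_line {σ a : ℝ} (hσ : 0 < σ) :
    Continuous fun t : ℝ => Complex.Gamma ((σ : ℂ) + ((a * t : ℝ) : ℂ) * Complex.I) := by
  rw [continuous_iff_continuousAt]
  intro t
  have h := (Complex.differentiableAt_Gamma ((σ : ℂ) + ((a * t : ℝ) : ℂ) * Complex.I) (by
    intro m hm
    have := congrArg Complex.re hm
    simp at this
    have : (0 : ℝ) ≤ m := m.cast_nonneg
    linarith)).continuousAt
  exact h.comp (f := fun t : ℝ => (σ : ℂ) + ((a * t : ℝ) : ℂ) * Complex.I)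
    (by fun_prop)

/-- Two uses of the functional equation write `Γ(s)` as `Γ(s + 2) / (s (s + 1))`, whose numerator is
bounded on the line. Quadratic decay is all that absolute convergence requires, so Stirling's
formula is avoided. -/
lemma norm_Gamma_line_le {σ : ℝ} (hσ : 0 < σ) (t : ℝ) :
    ‖Complex.Gamma ((σ : ℂ) + (t : ℂ) * Complex.I)‖ ≤
      Real.Gamma (σ + 2) / min (σ ^ 2) 1 * (1 + t ^ 2)⁻¹ := by
  set s : ℂ := (σ : ℂ) + (t : ℂ) * Complex.I with hs
  have hre : s.re = σ := by simp [hs]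
  have him : s.im = t := by simp [hs]
  have hs0 : s ≠ 0 := fun h => by rw [h] at hre; simp at hre; linarith
  have hs1 : s + 1 ≠ 0 := fun h => by
    have := congrArg Complex.re h
    simp [hre] at this; linarith
  have hG : Complex.Gamma (s + 2) = (s + 1) * s * Complex.Gamma s := by
    rw [show s + 2 = (s + 1) + 1 by ring, Complex.Gamma_add_one _ hs1, Complex.Gamma_add_one _ hs0]
    ring
  have h2 := norm_Gamma_le_Gamma_re (s := s + 2) (by simp [hre]; linarith)
  rw [hG, norm_mul, norm_mul] at h2
  have e1 : (s + 2).re = σ + 2 := by simp [hre]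
  rw [e1] at h2
  have hm : 0 < min (σ ^ 2) 1 := by positivity
  have n1 : ‖s‖ ^ 2 = σ ^ 2 + t ^ 2 := by
    rw [← Complex.normSq_eq_norm_sq, Complex.normSq_apply, hre, him]; ring
  have n2 : ‖s + 1‖ ^ 2 = (σ + 1) ^ 2 + t ^ 2 := by
    rw [← Complex.normSq_eq_norm_sq, Complex.normSq_apply]; simp [hre, him]; ring
  have n3 : ‖s‖ ≤ ‖s + 1‖ := by
    refine (sq_le_sq₀ (norm_nonneg _) (norm_nonneg _)).1 ?_
    rw [n1, n2]; nlinarith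
  have n4 : min (σ ^ 2) 1 * (1 + t ^ 2) ≤ ‖s + 1‖ * ‖s‖ := by
    calc min (σ ^ 2) 1 * (1 + t ^ 2) ≤ σ ^ 2 + t ^ 2 := by
          have a1 := min_le_left (σ ^ 2) 1
          have a2 := min_le_right (σ ^ 2) 1
          nlinarith [sq_nonneg t]
      _ = ‖s‖ * ‖s‖ := by rw [← n1]; ring
      _ ≤ _ := by gcongr
  rw [div_mul_eq_mul_div, le_div_iff₀ hm, ← div_eq_mul_inv, le_div_iff₀ (by positivity)]
  calc ‖Complex.Gamma s‖ * min (σ ^ 2) 1 * (1 + t ^ 2)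
      = (min (σ ^ 2) 1 * (1 + t ^ 2)) * ‖Complex.Gamma s‖ := by ring
    _ ≤ (‖s + 1‖ * ‖s‖) * ‖Complex.Gamma s‖ := by gcongr
    _ ≤ _ := h2

lemma integrable_Gamma_line {σ : ℝ} (hσ : 0 < σ) :
    Integrable fun t : ℝ => Complex.Gamma ((σ : ℂ) + (t : ℂ) * Complex.I) := by
  refine (integrable_inv_one_add_sq.const_mul (Real.Gamma (σ + 2) / min (σ ^ 2) 1)).mono' ?_
    (ae_of_all _ fun t => norm_Gamma_line_le hσ t)
  simpa using (continuous_Gamma_line (a := 1) hσ).aestronglyMeasurable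

lemma exp_neg_eq_integral_Gamma {σ x : ℝ} (hσ : 0 < σ) (hx : 0 < x) :
    (Real.exp (-x) : ℂ) = 1 / (2 * (Real.pi : ℂ)) * ∫ t : ℝ,
      Complex.Gamma ((σ : ℂ) + (t : ℂ) * Complex.I) * (x : ℂ) ^ (-((σ : ℂ) + (t : ℂ) * Complex.I))
      := by
  have hG : ∀ t : ℝ, mellin (fun x : ℝ => (Real.exp (-x) : ℂ)) ((σ : ℂ) + (t : ℂ) * Complex.I) =
      Complex.Gamma ((σ : ℂ) + (t : ℂ) * Complex.I) := fun t => by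
    rw [← Complex.GammaIntegral_eq_mellin, Complex.Gamma_eq_integral (by simpa using hσ)]
  have h := mellinInv_mellin_eq σ (fun x : ℝ => (Real.exp (-x) : ℂ)) hx ?_ ?_ (by fun_prop)
  · rw [← h, mellinInv, Complex.real_smul]
    rw [Complex.ofReal_div, Complex.ofReal_mul, Complex.ofReal_one, Complex.ofReal_ofNat]
    congr 2
    ext t
    rw [hG, smul_eq_mul, mul_comm]
  · have := Complex.GammaIntegral_convergent (s := σ) (by simpa using hσ)
    refine this.congr_fun (fun t _ => ?_) measurableSet_Ioi
    simp [mul_comm]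
  · refine (integrable_Gamma_line hσ).congr (ae_of_all _ fun t => (hG t).symm)

/-- Fubini for a weighted integral of `e^{-x}` and the Mellin inversion formula. -/
lemma integral_mul_exp_neg_eq_integral_Gamma {s : Set ℝ} (hs : MeasurableSet s) {σ : ℝ} (hσ : 0 < σ)
    {h x : ℝ → ℝ} (hx : ∀ u ∈ s, 0 < x u) (hxm : Measurable x)
    (hint : IntegrableOn (fun u => h u * x u ^ (-σ)) s) :
    ((∫ u in s, h u * Real.exp (-x u) : ℝ) : ℂ) = 1 / (2 * (Real.pi : ℂ)) * ∫ t : ℝ,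
      Complex.Gamma ((σ : ℂ) + (t : ℂ) * Complex.I) *
        ∫ u in s, (h u : ℂ) * (x u : ℂ) ^ (-((σ : ℂ) + (t : ℂ) * Complex.I)) := by
  have hI : Integrable (Function.uncurry fun (u t : ℝ) =>
      Complex.Gamma ((σ : ℂ) + (t : ℂ) * Complex.I) *
        ((h u : ℂ) * (x u : ℂ) ^ (-((σ : ℂ) + (t : ℂ) * Complex.I))))
      ((volume.restrict s).prod volume) := by
    have h0 : Integrable (fun q : ℝ × ℝ => ((h q.1 * x q.1 ^ (-σ) : ℝ) : ℂ) *
        Complex.Gamma ((σ : ℂ) + (q.2 : ℂ) * Complex.I)) ((volume.restrict s).prod volume) :=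
      Integrable.mul_prod (hint.ofReal (𝕜 := ℂ)) (integrable_Gamma_line hσ)
    -- The dependence on `t` of `x^(-(σ + it))` is a phase of modulus one, so the integrand is an
    -- integrable product `h x^(-σ) · Γ` times a bounded factor.
    have hph : Measurable fun q : ℝ × ℝ => (x q.1 : ℂ) ^ (-((q.2 : ℂ) * Complex.I)) := by
      apply Measurable.pow <;> fun_prop
    have hae : ∀ᵐ q ∂(volume.restrict s).prod (volume : Measure ℝ), q.1 ∈ s := by
      have : ∀ᵐ u ∂(volume.restrict s), u ∈ s := ae_restrict_mem hs
      exact Measure.quasiMeasurePreserving_fst.ae this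
    have h1 := h0.mul_bdd (c := 1) hph.aestronglyMeasurable (by
      filter_upwards [hae] with q hq
      rw [Complex.norm_cpow_eq_rpow_re_of_pos (hx _ hq)]
      simp)
    refine h1.congr ?_
    filter_upwards [hae] with q hq
    have hx0 : (x q.1 : ℂ) ≠ 0 := by exact_mod_cast (hx _ hq).ne'
    simp only [Function.uncurry]
    rw [neg_add, Complex.cpow_add _ _ hx0]
    rw [Complex.ofReal_mul, Complex.ofReal_cpow (hx _ hq).le, Complex.ofReal_neg]
    ring
  calc ((∫ u in s, h u * Real.exp (-x u) : ℝ) : ℂ)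
      = ∫ u in s, ((h u * Real.exp (-x u) : ℝ) : ℂ) := integral_ofReal.symm
    _ = ∫ u in s, 1 / (2 * (Real.pi : ℂ)) * ∫ t : ℝ,
          Complex.Gamma ((σ : ℂ) + (t : ℂ) * Complex.I) *
            ((h u : ℂ) * (x u : ℂ) ^ (-((σ : ℂ) + (t : ℂ) * Complex.I))) := by
        refine setIntegral_congr_fun hs fun u hu => ?_
        simp only [Complex.ofReal_mul]
        rw [exp_neg_eq_integral_Gamma hσ (hx u hu), mul_left_comm, ← integral_const_mul]
        congr 2; ext t; ring
    _ = _ := by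
        rw [integral_const_mul, integral_integral_swap hI]
        simp_rw [integral_const_mul]

/-- The definition picks an unspecified separating line; a common value `V` on all of them settles
both the value and the independence of the choice. -/
lemma meijerG_of_forall_line {m n p q : ℕ} {a : Fin p → ℂ} {b : Fin q → ℂ} {z V : ℂ}
    (hex : ∃ c, IsMeijerLine m n a b c)
    (hline : ∀ c, IsMeijerLine m n a b c →
      Integrable (fun t : ℝ => meijerIntegrand m n a b z ((c : ℂ) + (t : ℂ) * Complex.I)) ∧
      meijerLineIntegral m n a b z c = V) :
    MeijerGWellDefined m n a b z ∧ meijerG m n a b z = V := by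
  have hV : meijerG m n a b z = V := by
    rw [meijerG, dif_pos hex]
    exact (hline _ hex.choose_spec).2
  exact ⟨⟨hex, fun c hc => ⟨(hline c hc).1, (hline c hc).2.trans hV.symm⟩⟩, hV⟩

/-- The quotient `Γ(s) / Γ(1 + s)` is `1 / s`, and `z^s / s` is the integral of `u^(s-1)` over `(0,
z]`. The remaining factor `Γ(δ - s)` is the Mellin kernel of `e^(-u)` at `w = δ - s`. -/
lemma meijerG_one_one_one_two {δ z : ℝ} (hδ : 0 < δ) (hz : 0 < z) :
    MeijerGWellDefined 1 1 ![1] ![(δ : ℂ), 0] (z : ℂ) ∧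
      meijerG 1 1 ![1] ![(δ : ℂ), 0] (z : ℂ) = (lowerGamma δ z : ℂ) := by
  have hiff : ∀ c, IsMeijerLine 1 1 ![1] ![(δ : ℂ), 0] c ↔ c < δ ∧ 0 < c := by
    intro c
    simp [IsMeijerLine]
  refine meijerG_of_forall_line ⟨δ / 2, (hiff _).2 ⟨by linarith, by linarith⟩⟩ fun c hc => ?_
  obtain ⟨hcδ, hc0⟩ := (hiff c).1 hc
  have hσ : 0 < δ - c := by linarith
  have hz0 : (z : ℂ) ≠ 0 := by exact_mod_cast hz.ne'
  have hs0 : ∀ t : ℝ, (c : ℂ) + (t : ℂ) * Complex.I ≠ 0 := fun t h => by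
    have := congrArg Complex.re h
    simp at this; linarith
  have hf : ∀ t : ℝ, meijerIntegrand 1 1 ![1] ![(δ : ℂ), 0] (z : ℂ) ((c : ℂ) + (t : ℂ) * Complex.I)
      = Complex.Gamma (((δ - c : ℝ) : ℂ) + ((-t : ℝ) : ℂ) * Complex.I) *
        ((z : ℂ) ^ ((c : ℂ) + (t : ℂ) * Complex.I) / ((c : ℂ) + (t : ℂ) * Complex.I)) := by
    intro t
    have hG : Complex.Gamma ((c : ℂ) + (t : ℂ) * Complex.I) ≠ 0 :=
      Complex.Gamma_ne_zero_of_re_pos (by simpa using hc0)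
    have e : (δ : ℂ) - ((c : ℂ) + (t : ℂ) * Complex.I) =
      ((δ - c : ℝ) : ℂ) + ((-t : ℝ) : ℂ) * Complex.I := by push_cast; ring
    simp only [meijerIntegrand, Fin.prod_univ_two, Finset.univ_unique, Finset.prod_singleton]
    simp only [Fin.val_zero, Fin.val_one, zero_lt_one, lt_irrefl, if_true, if_false,
      Matrix.cons_val_zero, Matrix.cons_val_one, Fin.default_eq_zero, e]
    rw [sub_zero, sub_self, zero_add, add_comm 1, Complex.Gamma_add_one _ (hs0 t)]
    have h0 := hs0 t
    set s := (c : ℂ) + (t : ℂ) * Complex.I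
    field_simp
  have hinner : ∀ t : ℝ, ∫ u in Set.Ioc 0 z, ((u ^ (δ - 1) : ℝ) : ℂ) *
      (u : ℂ) ^ (-(((δ - c : ℝ) : ℂ) + (t : ℂ) * Complex.I)) =
      (z : ℂ) ^ ((c : ℂ) + ((-t : ℝ) : ℂ) * Complex.I) /
        ((c : ℂ) + ((-t : ℝ) : ℂ) * Complex.I) := by
    intro t
    have := integral_cpow (a := 0) (b := z)
      (r := (c : ℂ) + ((-t : ℝ) : ℂ) * Complex.I - 1) (Or.inl (by simpa using hc0))
    rw [sub_add_cancel, Complex.ofReal_zero, Complex.zero_cpow (hs0 _), sub_zero,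
      intervalIntegral.integral_of_le hz.le] at this
    rw [← this]
    refine setIntegral_congr_fun measurableSet_Ioc fun u hu => ?_
    have hu0 : (u : ℂ) ≠ 0 := by exact_mod_cast hu.1.ne'
    rw [Complex.ofReal_cpow hu.1.le, ← Complex.cpow_add _ _ hu0]
    congr 1; push_cast; ring
  constructor
  · simp_rw [hf]
    refine (integrable_Gamma_line hσ).comp_neg.mul_bdd (c := z ^ c / c) ?_ (ae_of_all _ fun t => ?_)
    · refine Continuous.aestronglyMeasurable (Continuous.div ?_ (by fun_prop) hs0)
      exact Continuous.const_cpow (by fun_prop) (Or.inl hz0)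
    · rw [norm_div, Complex.norm_cpow_eq_rpow_re_of_pos hz]
      have h1 : c ≤ ‖(c : ℂ) + (t : ℂ) * Complex.I‖ := by
        simpa using Complex.re_le_norm ((c : ℂ) + (t : ℂ) * Complex.I)
      have h2 : ((c : ℂ) + (t : ℂ) * Complex.I).re = c := by simp
      rw [h2]
      gcongr
  · have := integral_mul_exp_neg_eq_integral_Gamma (s := Set.Ioc 0 z) measurableSet_Ioc hσ
      (h := fun u => u ^ (δ - 1)) (x := fun u => u) (fun u hu => hu.1) measurable_id (by
        have hi := (intervalIntegral.intervalIntegrable_rpow' (a := 0) (b := z) (r := c - 1)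
          (by linarith))
        rw [intervalIntegrable_iff_integrableOn_Ioc_of_le hz.le] at hi
        refine hi.congr_fun (fun u hu => ?_) measurableSet_Ioc
        simp only
        rw [← Real.rpow_add hu.1]; congr 1; ring)
    -- The variable `w = δ - s` runs along its line in the opposite direction, hence the reflection
    -- of `t`.
    rw [lowerGamma, this, meijerLineIntegral, ← integral_neg_eq_self]
    congr 2
    ext t
    rw [hf, hinner, neg_neg]

/-- Duplication merges `Γ(-s) Γ(1/2 - s)` into `2^(1+2s) √π Γ(-2s)`, the Mellin kernel at `w = -2s`.
Euler's integral for `Γ(A + s)` then supplies the weight, with `(4z)^s u^s = (2√(zu))^(2s)`. -/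
lemma meijerG_two_one_one_two {A z : ℝ} (hA : 0 < A) (hz : 0 < z) :
    MeijerGWellDefined 2 1 ![((1 - A : ℝ) : ℂ)] ![0, 1 / 2] (z : ℂ) ∧
      meijerG 2 1 ![((1 - A : ℝ) : ℂ)] ![0, 1 / 2] (z : ℂ) =
        ((√Real.pi * ∫ u in Set.Ioi 0, u ^ (A - 1) * Real.exp (-u) * Real.exp (-(2 * √(z * u))) : ℝ)
          : ℂ) := by
  have hiff : ∀ c : ℝ, IsMeijerLine 2 1 ![((1 - A : ℝ) : ℂ)] ![0, 1 / 2] c ↔ c < 0 ∧ -A < c := by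
    intro c
    simp [IsMeijerLine, Fin.forall_fin_two]
    intro _ _
    linarith
  refine meijerG_of_forall_line ⟨-A / 2, (hiff _).2 ⟨by linarith, by linarith⟩⟩ fun c hc => ?_
  obtain ⟨hc0, hcA⟩ := (hiff c).1 hc
  have hσ : 0 < -2 * c := by linarith
  have hAc : 0 < A + c := by linarith
  have hz0 : (z : ℂ) ≠ 0 := by exact_mod_cast hz.ne'
  have hf : ∀ t : ℝ, meijerIntegrand 2 1 ![((1 - A : ℝ) : ℂ)] ![0, 1 / 2] (z : ℂ)
      ((c : ℂ) + (t : ℂ) * Complex.I)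
      = Complex.Gamma (((-2 * c : ℝ) : ℂ) + ((-2 * t : ℝ) : ℂ) * Complex.I) *
        (2 * √Real.pi * (Complex.Gamma (((A + c : ℝ) : ℂ) + ((1 * t : ℝ) : ℂ) * Complex.I) *
          (4 * (z : ℂ)) ^ ((c : ℂ) + (t : ℂ) * Complex.I))) := by
    intro t
    set s := (c : ℂ) + (t : ℂ) * Complex.I with hs
    simp only [meijerIntegrand, Fin.prod_univ_two, Finset.univ_unique, Finset.prod_singleton]
    simp only [Fin.val_zero, Fin.val_one, zero_lt_one, one_lt_two, zero_lt_two, if_true,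
      Matrix.cons_val_zero, Matrix.cons_val_one, Fin.default_eq_zero]
    rw [show (1 / 2 : ℂ) - s = (0 - s) + 1 / 2 by ring, Complex.Gamma_mul_Gamma_add_half,
      show (2 : ℂ) * (0 - s) = ((-2 * c : ℝ) : ℂ) + ((-2 * t : ℝ) : ℂ) * Complex.I by
        rw [hs]; push_cast; ring,
      show (1 - ((1 - A : ℝ) : ℂ) + s) = ((A + c : ℝ) : ℂ) + ((1 * t : ℝ) : ℂ) * Complex.I by
        rw [hs]; push_cast; ring]
    have h4 : (4 * (z : ℂ)) ^ s = 2 ^ (2 * s) * (z : ℂ) ^ s := by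
      have e1 := Complex.mul_cpow_ofReal_nonneg (a := 4) (b := z) (by norm_num) hz.le s
      have e2 := Complex.mul_cpow_ofReal_nonneg (a := 2) (b := 2) (by norm_num) (by norm_num) s
      have e3 := Complex.cpow_nat_mul 2 2 s
      push_cast at e1 e2 e3
      rw [e1, e3, sq, ← e2]
      norm_num
    have h2 : (2 : ℂ) ^ (1 - (((-2 * c : ℝ) : ℂ) + ((-2 * t : ℝ) : ℂ) * Complex.I)) =
        2 * 2 ^ (2 * s) := by
      rw [show 1 - (((-2 * c : ℝ) : ℂ) + ((-2 * t : ℝ) : ℂ) * Complex.I) = 1 + 2 * s by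
        rw [hs]; push_cast; ring, Complex.cpow_add _ _ two_ne_zero, Complex.cpow_one]
    rw [h2, h4]
    ring
  have hinner : ∀ t : ℝ, ∫ u in Set.Ioi 0, ((u ^ (A - 1) * Real.exp (-u) : ℝ) : ℂ) *
      ((2 * √(z * u) : ℝ) : ℂ) ^ (-(((-2 * c : ℝ) : ℂ) + ((-2 * t : ℝ) : ℂ) * Complex.I)) =
      Complex.Gamma (((A + c : ℝ) : ℂ) + ((1 * t : ℝ) : ℂ) * Complex.I) *
          (4 * (z : ℂ)) ^ ((c : ℂ) + (t : ℂ) * Complex.I) := by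
    intro t
    set s := (c : ℂ) + (t : ℂ) * Complex.I with hs
    have e1 : ((A + c : ℝ) : ℂ) + ((1 * t : ℝ) : ℂ) * Complex.I = A + s := by
      rw [hs]; push_cast; ring
    have e2 : -(((-2 * c : ℝ) : ℂ) + ((-2 * t : ℝ) : ℂ) * Complex.I) = 2 * s := by
      rw [hs]; push_cast; ring
    rw [e1, e2, Complex.Gamma_eq_integral (by simpa [hs] using hAc), Complex.GammaIntegral,
      ← integral_mul_const]
    refine setIntegral_congr_fun measurableSet_Ioi fun u (hu : 0 < u) => ?_
    have hu0 : (u : ℂ) ≠ 0 := by exact_mod_cast hu.ne'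
    have e3 : ((2 * √(z * u) : ℝ) : ℂ) ^ (2 * s) = (4 * (z : ℂ)) ^ s * (u : ℂ) ^ s := by
      have e3 := Complex.cpow_nat_mul ((2 * √(z * u) : ℝ) : ℂ) 2 s
      rw [Nat.cast_ofNat] at e3
      have e4 := Complex.mul_cpow_ofReal_nonneg (a := 4 * z) (b := u) (by positivity) hu.le s
      have e5 := Complex.mul_cpow_ofReal_nonneg (a := 2 * √(z * u)) (b := 2 * √(z * u))
        (by positivity) (by positivity) s
      rw [e3, sq, ← e5, ← Complex.ofReal_mul,
        show 2 * √(z * u) * (2 * √(z * u)) = 4 * z * u by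
          nlinarith [Real.mul_self_sqrt (mul_pos hz hu).le], Complex.ofReal_mul, e4]
      push_cast
      rfl
    rw [e3, Complex.ofReal_mul, Complex.ofReal_cpow hu.le,
      show (A : ℂ) + s - 1 = ((A - 1 : ℝ) : ℂ) + s by push_cast; ring,
      Complex.cpow_add ((A - 1 : ℝ) : ℂ) s hu0]
    ring
  constructor
  · simp_rw [hf]
    have h1 := (integrable_Gamma_line hσ).comp_mul_left' (R := -2) (by norm_num)
    refine h1.mul_bdd (c := 2 * √Real.pi * (Real.Gamma (A + c) * (4 * z) ^ c)) ?_
      (ae_of_all _ fun t => ?_)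
    · refine Continuous.aestronglyMeasurable (continuous_const.mul
        ((continuous_Gamma_line hAc).mul ?_))
      exact Continuous.const_cpow (by fun_prop) (Or.inl (by simpa using hz0))
    · have h4 := Complex.norm_cpow_eq_rpow_re_of_pos (x := 4 * z) (by positivity)
        ((c : ℂ) + (t : ℂ) * Complex.I)
      have h5 := norm_Gamma_le_Gamma_re (s := ((A + c : ℝ) : ℂ) + ((1 * t : ℝ) : ℂ) * Complex.I)
        (by simpa using hAc)
      simp only [Complex.add_re, Complex.ofReal_re, Complex.re_ofReal_mul, Complex.I_re, mul_zero,
        add_zero, Complex.ofReal_mul, Complex.ofReal_ofNat] at h4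
      rw [show (((A + c : ℝ) : ℂ) + ((1 * t : ℝ) : ℂ) * Complex.I).re = A + c by simp] at h5
      rw [norm_mul, norm_mul, norm_mul, h4, Complex.norm_real, Real.norm_eq_abs,
        abs_of_nonneg (Real.sqrt_nonneg _), Complex.norm_ofNat]
      gcongr
  · have := integral_mul_exp_neg_eq_integral_Gamma (s := Set.Ioi 0) measurableSet_Ioi hσ
      (h := fun u => u ^ (A - 1) * Real.exp (-u)) (x := fun u => 2 * √(z * u))
      (fun u (hu : 0 < u) => by positivity) (by fun_prop) (by
        refine IntegrableOn.congr_fun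
          (f := fun u => (4 * z) ^ c * (Real.exp (-u) * u ^ (A + c - 1)))
          ((Real.GammaIntegral_convergent hAc).const_mul _)
          (fun u (hu : 0 < u) => ?_) measurableSet_Ioi
        have e1 : (2 * √(z * u)) ^ (-(-2 * c)) = (4 * z) ^ c * u ^ c := by
          rw [← Real.mul_rpow (by positivity) hu.le, show -(-2 * c) = 2 * c by ring,
            Real.rpow_mul (by positivity), Real.rpow_two]
          congr 1
          nlinarith [Real.sq_sqrt (mul_pos hz hu).le]
        simp only
        rw [e1, show A + c - 1 = (A - 1) + c by ring, Real.rpow_add hu]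
        ring)
    rw [Complex.ofReal_mul, this, meijerLineIntegral, mul_left_comm]
    congr 1
    -- Passing from `s` to `w = -2s` costs a Jacobian `1/2`, which cancels the factor `2` left by
    -- the duplication formula.
    have hsub := Measure.integral_comp_mul_left (fun t : ℝ => (√Real.pi : ℂ) *
      (Complex.Gamma (((-2 * c : ℝ) : ℂ) + (t : ℂ) * Complex.I) *
        ∫ u in Set.Ioi 0, ((u ^ (A - 1) * Real.exp (-u) : ℝ) : ℂ) *
      ((2 * √(z * u) : ℝ) : ℂ) ^ (-(((-2 * c : ℝ) : ℂ) + (t : ℂ) * Complex.I)))) (-2)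
    have habs : |(-2 : ℝ)⁻¹| = 1 / 2 := by rw [abs_inv]; norm_num
    rw [habs, Complex.real_smul] at hsub
    rw [integral_const_mul, integral_const_mul] at hsub
    calc _ = ∫ t : ℝ, 2 * ((√Real.pi : ℂ) *
      (Complex.Gamma (((-2 * c : ℝ) : ℂ) + ((-2 * t : ℝ) : ℂ) * Complex.I) *
        ∫ u in Set.Ioi 0, ((u ^ (A - 1) * Real.exp (-u) : ℝ) : ℂ) *
      ((2 * √(z * u) : ℝ) : ℂ) ^
        (-(((-2 * c : ℝ) : ℂ) + ((-2 * t : ℝ) : ℂ) * Complex.I)))) := by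
          congr 1
          ext t
          rw [hf, hinner]
          ring
      _ = _ := by
          rw [integral_const_mul, integral_const_mul, hsub]
          push_cast
          ring

/-! ### The Gamma law -/

section GammaLaw

variable {a r : ℝ}

lemma ae_pos_gammaMeasure (a r : ℝ) : ∀ᵐ x ∂gammaMeasure a r, 0 < x := by
  have h : ∀ᵐ x ∂gammaMeasure a r, x ∈ Set.Ici (0 : ℝ) := by
    rw [gammaMeasure, ae_withDensity_iff (by unfold gammaPDF; fun_prop)]
    refine ae_of_all _ fun x hx => ?_
    by_contra h
    exact hx (gammaPDF_of_neg (by simpa using h))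
  have h0 : ∀ᵐ x ∂gammaMeasure a r, x ≠ 0 :=
    (withDensity_absolutelyContinuous _ _).ae_le (Measure.ae_ne volume 0)
  filter_upwards [h, h0] with x hx hx0
  exact lt_of_le_of_ne hx (Ne.symm hx0)

lemma integral_gammaMeasure (ha : 0 < a) (hr : 0 < r) (f : ℝ → ℝ) :
    ∫ x, f x ∂gammaMeasure a r =
      ∫ x in Set.Ioi 0, r ^ a / Real.Gamma a * x ^ (a - 1) * Real.exp (-(r * x)) * f x := by
  rw [gammaMeasure, show gammaPDF a r = fun x => ENNReal.ofReal (gammaPDFReal a r x) from rfl,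
    integral_withDensity_eq_integral_toReal_smul
    (measurable_gammaPDFReal a r).ennreal_ofReal
    (ae_of_all _ fun x => ENNReal.ofReal_lt_top), ← integral_Ici_eq_integral_Ioi,
    ← integral_indicator measurableSet_Ici]
  congr 1
  ext x
  rw [ENNReal.toReal_ofReal (gammaPDFReal_nonneg ha hr x), gammaPDFReal, smul_eq_mul,
    Set.indicator_apply]
  simp only [Set.mem_Ici]
  split_ifs <;> simp

lemma integrable_gammaMeasure_iff (ha : 0 < a) (hr : 0 < r) (f : ℝ → ℝ) :
    Integrable f (gammaMeasure a r) ↔ IntegrableOn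
      (fun x => r ^ a / Real.Gamma a * x ^ (a - 1) * Real.exp (-(r * x)) * f x) (Set.Ioi 0) := by
  rw [gammaMeasure, show gammaPDF a r = fun x => ENNReal.ofReal (gammaPDFReal a r x) from rfl,
    integrable_withDensity_iff_integrable_smul'
    (measurable_gammaPDFReal a r).ennreal_ofReal
    (ae_of_all _ fun x => ENNReal.ofReal_lt_top), ← integrableOn_Ici_iff_integrableOn_Ioi,
    ← integrable_indicator_iff measurableSet_Ici]
  refine iff_of_eq (congrArg (Integrable · volume) ?_)
  ext x
  rw [ENNReal.toReal_ofReal (gammaPDFReal_nonneg ha hr x), gammaPDFReal, smul_eq_mul,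
    Set.indicator_apply]
  simp only [Set.mem_Ici]
  split_ifs <;> simp

lemma integrable_rpow_gammaMeasure (ha : 0 < a) (hr : 0 < r) {q : ℝ} (hq : 0 < a + q) :
    Integrable (fun x => x ^ q) (gammaMeasure a r) := by
  rw [integrable_gammaMeasure_iff ha hr]
  have h := (integrableOn_rpow_mul_exp_neg_mul_rpow (p := 1) (s := a + q - 1) (b := r)
    (by linarith) one_pos hr)
  refine IntegrableOn.congr_fun (h.const_mul (r ^ a / Real.Gamma a)) (fun x (hx : 0 < x) => ?_)
    measurableSet_Ioi
  simp only [Real.rpow_one]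
  rw [show a + q - 1 = (a - 1) + q by ring, Real.rpow_add hx]
  ring_nf

lemma integral_rpow_gammaMeasure (ha : 0 < a) (hr : 0 < r) {q : ℝ} (hq : 0 < a + q) :
    ∫ x, x ^ q ∂gammaMeasure a r = Real.Gamma (a + q) / Real.Gamma a * r ^ (-q) := by
  rw [integral_gammaMeasure ha hr]
  have h := Real.integral_rpow_mul_exp_neg_mul_Ioi hq hr
  calc _ = ∫ x in Set.Ioi 0, r ^ a / Real.Gamma a * (x ^ (a + q - 1) * Real.exp (-(r * x))) := by
        refine setIntegral_congr_fun measurableSet_Ioi fun x (hx : 0 < x) => ?_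
        rw [show a + q - 1 = (a - 1) + q by ring, Real.rpow_add hx]
        ring
    _ = _ := by
        rw [integral_const_mul, h, one_div, Real.inv_rpow hr.le, Real.rpow_add hr, Real.rpow_neg hr.le]
        have := (Real.Gamma_pos_of_pos ha).ne'
        have := (Real.rpow_pos_of_pos hr a).ne'
        have := (Real.rpow_pos_of_pos hr q).ne'
        field_simp

lemma mgf_id_gammaMeasure (ha : 0 < a) (hr : 0 < r) (t : ℝ) :
    mgf id (gammaMeasure a r) t = if t < r then (r / (r - t)) ^ a else 0 := by
  have hG := (Real.Gamma_pos_of_pos ha).ne'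
  have hra := (Real.rpow_pos_of_pos hr a).ne'
  have e : mgf id (gammaMeasure a r) t = ∫ x in Set.Ioi 0,
      r ^ a / Real.Gamma a * (x ^ (a - 1) * Real.exp (-((r - t) * x))) := by
    rw [mgf, integral_gammaMeasure ha hr]
    refine setIntegral_congr_fun measurableSet_Ioi fun x _ => ?_
    simp only [id]
    rw [mul_assoc, mul_assoc, ← Real.exp_add]
    ring_nf
  rw [e, integral_const_mul]
  split_ifs with h
  · have h' : 0 < r - t := by linarith
    rw [Real.integral_rpow_mul_exp_neg_mul_Ioi ha h', Real.div_rpow hr.le h'.le,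
      Real.div_rpow zero_le_one h'.le, Real.one_rpow]
    field_simp
  -- For `t ≥ r` the integrand dominates `x^(a-1)`, and no power is integrable on the whole
  -- half-line; the value `0` is the default of a divergent integral.
  · rw [integral_undef, mul_zero]
    intro hi
    refine not_integrableOn_Ioi_rpow (a - 1) (hi.mono' ?_ ?_)
    · exact (measurable_id.pow_const _).aestronglyMeasurable
    · refine (ae_restrict_iff' measurableSet_Ioi).2 (ae_of_all _ fun x (hx : 0 < x) => ?_)
      have h0 : 0 ≤ x ^ (a - 1) := Real.rpow_nonneg hx.le _
      rw [Real.norm_of_nonneg h0]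
      refine le_mul_of_one_le_right h0 (Real.one_le_exp ?_)
      push Not at h
      nlinarith

lemma zero_mem_interior_integrableExpSet_gammaMeasure (ha : 0 < a) (hr : 0 < r) :
    (0 : ℝ) ∈ interior (integrableExpSet id (gammaMeasure a r)) := by
  rw [mem_interior]
  refine ⟨Set.Iio r, fun t (ht : t < r) => ?_, isOpen_Iio, hr⟩
  by_contra h
  have h0 := mgf_undef h
  rw [mgf_id_gammaMeasure ha hr, if_pos ht] at h0
  have : 0 < (r / (r - t)) ^ a := Real.rpow_pos_of_pos (div_pos hr (by linarith)) _
  linarith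

/-- The sum of independent Gamma variables with a common rate. -/
lemma hasLaw_sum_gammaMeasure {Ω : Type*} [MeasurableSpace Ω] {P : Measure Ω}
    [IsProbabilityMeasure P] {N : ℕ} (hN : 0 < N) (ha : 0 < a) (hr : 0 < r) {X : Fin N → Ω → ℝ}
    (hind : iIndepFun X P) (hX : ∀ n, HasLaw (X n) (gammaMeasure a r) P) :
    HasLaw (fun ω => ∑ n, X n ω) (gammaMeasure (a * N) r) P := by
  have hNa : 0 < a * N := by positivity
  have hprob := isProbabilityMeasure_gammaMeasure hNa hr
  have hm : AEMeasurable (fun ω => ∑ n, X n ω) P := by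
    have := fun n => (hX n).aemeasurable
    fun_prop
  refine ⟨hm, ?_⟩
  have hmgf : mgf id (gammaMeasure (a * N) r) = mgf (fun ω => ∑ n, X n ω) P := by
    ext t
    have h1 := hind.mgf_sum₀ (t := t) (fun n => (hX n).aemeasurable) Finset.univ
    have h2 : (∑ n, X n) = fun ω => ∑ n, X n ω := by ext ω; simp
    have h3 : ∀ n, mgf (X n) P t = mgf id (gammaMeasure a r) t := fun n => by
      rw [← (hX n).map_eq, mgf_id_map (hX n).aemeasurable]
    rw [← h2, h1]
    simp_rw [h3]
    rw [Finset.prod_const, Finset.card_univ, Fintype.card_fin, mgf_id_gammaMeasure hNa hr,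
      mgf_id_gammaMeasure ha hr]
    split_ifs with h
    · rw [Real.rpow_mul (div_pos hr (by linarith)).le, Real.rpow_natCast]
    -- Beyond the rate both sides take the default value `0`; this needs at least one summand.
    · rw [zero_pow hN.ne']
  -- Equal real moment generating functions extend to equal complex ones on the strip over the
  -- interior of the domain. That strip contains the imaginary axis, where they are characteristic
  -- functions.
  have heq := eqOn_complexMGF_of_mgf hmgf
  have : IsProbabilityMeasure (P.map fun ω => ∑ n, X n ω) := Measure.isProbabilityMeasure_map hm
  refine Measure.ext_of_charFun ?_
  ext t
  rw [← complexMGF_mul_I hm, ← complexMGF_id_mul_I]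
  refine (heq ?_).symm
  simpa using zero_mem_interior_integrableExpSet_gammaMeasure hNa hr

end GammaLaw

/-! ### The Nakagami law -/

/-- The substitution `y = x²` on `(0, ∞)` has Jacobian `2x`, which accounts exactly for the
difference between the two densities; neither law charges the negative half-line. -/
lemma map_sq_nakagamiMeasure {m w : ℝ} (hm : 0 < m) (hw : 0 < w) :
    (nakagamiMeasure m w).map (fun x => x ^ 2) = gammaMeasure m (m / w) := by
  ext s hs
  rw [Measure.map_apply (by fun_prop) hs, nakagamiMeasure, gammaMeasure,
    withDensity_apply _ (by measurability), withDensity_apply _ hs,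
    ← lintegral_indicator (by measurability), ← lintegral_indicator hs]
  have himg : (fun x : ℝ => x ^ 2) '' Set.Ioi 0 = Set.Ioi 0 := by
    ext y
    constructor
    · rintro ⟨x, hx, rfl⟩
      exact pow_pos (Set.mem_Ioi.1 hx) 2
    · intro (hy : 0 < y)
      exact ⟨√y, Real.sqrt_pos.2 hy, Real.sq_sqrt hy.le⟩
  have hG : ∫⁻ x, s.indicator (gammaPDF m (m / w)) x =
      ∫⁻ x in Set.Ioi 0, s.indicator (gammaPDF m (m / w)) x := by
    rw [← lintegral_add_compl _ measurableSet_Ici (A := Set.Ici (0 : ℝ)),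
      setLIntegral_congr Ioi_ae_eq_Ici.symm]
    convert add_zero _
    rw [setLIntegral_congr_fun (g := fun _ => 0) measurableSet_Ici.compl, lintegral_zero]
    intro x hx
    have hx' : x < 0 := by simpa using hx
    simp [gammaPDF_of_neg hx']
  rw [hG]
  conv_rhs => rw [← himg]
  rw [lintegral_image_eq_lintegral_abs_deriv_mul measurableSet_Ioi
    (fun x _ => (hasDerivAt_pow 2 x).hasDerivWithinAt)
    (fun x (hx : 0 < x) y (hy : 0 < y) h => (sq_eq_sq₀ hx.le hy.le).1 h),
    ← lintegral_indicator measurableSet_Ioi]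
  refine lintegral_congr fun x => ?_
  by_cases hx : 0 < x
  · rw [Set.indicator_of_mem (Set.mem_Ioi.2 hx)]
    by_cases hxs : x ^ 2 ∈ s
    · rw [Set.indicator_of_mem (s := (fun x : ℝ => x ^ 2) ⁻¹' s) (a := x) hxs, Set.indicator_of_mem hxs, gammaPDF, ← ENNReal.ofReal_mul (abs_nonneg _), nakagamiPDFReal, if_pos hx, gammaPDFReal,
        if_pos (sq_nonneg x)]
      congr 1
      rw [← Real.rpow_natCast x 2, ← Real.rpow_mul hx.le, Real.div_rpow hm.le hw.le]
      rw [show 2 * m - 1 = ((2 : ℕ) : ℝ) * (m - 1) + 1 by push_cast; ring, Real.rpow_add hx,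
        Real.rpow_one, abs_of_pos (by positivity)]
      have := (Real.rpow_pos_of_pos hw m).ne'
      have := (Real.Gamma_pos_of_pos hm).ne'
      push_cast
      rw [neg_mul]
      simp
      field_simp
    · rw [Set.indicator_of_notMem (s := (fun x : ℝ => x ^ 2) ⁻¹' s) (a := x) hxs, Set.indicator_of_notMem hxs, mul_zero]
  · rw [Set.indicator_of_notMem (s := Set.Ioi _) (by simpa using hx)]
    simp [nakagamiPDFReal, hx]

lemma hasLaw_sq_of_nakagami {Ω : Type*} [MeasurableSpace Ω] {P : Measure Ω} {X : Ω → ℝ} {m w : ℝ}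
    (hm : 0 < m) (hw : 0 < w) (hX : HasLaw X (nakagamiMeasure m w) P) :
    HasLaw (fun ω => X ω ^ 2) (gammaMeasure m (m / w)) P := by
  have : HasLaw (fun x : ℝ => x ^ 2) (gammaMeasure m (m / w)) (nakagamiMeasure m w) :=
    ⟨by fun_prop, map_sq_nakagamiMeasure hm hw⟩
  exact this.comp hX

section Moments

variable {Ω : Type*} [MeasurableSpace Ω] {P : Measure Ω} {X : Ω → ℝ} {m w : ℝ}

lemma memLp_two_of_nakagami (hm : 0 < m) (hw : 0 < w) (hX : HasLaw X (nakagamiMeasure m w) P) :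
    MemLp X 2 P := by
  rw [memLp_two_iff_integrable_sq hX.aemeasurable.aestronglyMeasurable]
  have h := hasLaw_sq_of_nakagami hm hw hX
  have hi := integrable_rpow_gammaMeasure (q := 1) hm (div_pos hm hw) (by linarith)
  rw [← h.map_eq, integrable_map_measure (by fun_prop) h.aemeasurable] at hi
  simpa [Function.comp_def] using hi

lemma integral_sq_of_nakagami (hm : 0 < m) (hw : 0 < w) (hX : HasLaw X (nakagamiMeasure m w) P) :
    ∫ ω, X ω ^ 2 ∂P = w := by
  have h := hasLaw_sq_of_nakagami hm hw hX
  rw [h.integral_eq]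
  have hi := integral_rpow_gammaMeasure (q := 1) hm (div_pos hm hw) (by linarith)
  simp only [Real.rpow_one] at hi
  rw [hi, Real.Gamma_add_one hm.ne', Real.rpow_neg_one]
  have := (Real.Gamma_pos_of_pos hm).ne'
  field_simp

/-- Nonnegativity makes `X` the square root of its square, so its mean is the moment of order `1/2`
of a Gamma law. -/
lemma integral_of_nakagami (hm : 0 < m) (hw : 0 < w) (hX : HasLaw X (nakagamiMeasure m w) P)
    (h0 : ∀ ω, 0 ≤ X ω) :
    ∫ ω, X ω ∂P = Real.Gamma (m + 1 / 2) / Real.Gamma m * (w / m) ^ (1 / 2 : ℝ) := by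
  have h := hasLaw_sq_of_nakagami hm hw hX
  have hi := integral_rpow_gammaMeasure (q := 1 / 2) hm (div_pos hm hw) (by linarith)
  rw [Real.rpow_neg (div_pos hm hw).le, ← Real.inv_rpow (div_pos hm hw).le, inv_div] at hi
  rw [← hi, ← h.integral_comp (by fun_prop)]
  congr 1
  ext ω
  simp only [Function.comp]
  rw [← Real.sqrt_eq_rpow, Real.sqrt_sq (h0 ω)]

end Moments

/-- A strict case of the log-convexity of the Gamma function. -/
lemma Gamma_add_half_sq_lt {m : ℝ} (hm : 0 < m) :
    Real.Gamma (m + 1 / 2) ^ 2 < m * Real.Gamma m ^ 2 := by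
  have key : ∀ x : ℝ, 0 < x → Real.Gamma (x + 1 / 2) ^ 2 ≤ x * Real.Gamma x ^ 2 := by
    intro x hx
    have hG := Real.Gamma_pos_of_pos hx
    have h := Real.Gamma_mul_add_mul_le_rpow_Gamma_mul_rpow_Gamma (s := x) (t := x + 1) (a := 1 / 2)
      (b := 1 / 2) hx (by linarith) (by norm_num) (by norm_num) (by norm_num)
    rw [show 1 / 2 * x + 1 / 2 * (x + 1) = x + 1 / 2 by ring, Real.Gamma_add_one hx.ne',
      ← Real.mul_rpow hG.le (by positivity), ← Real.sqrt_eq_rpow] at h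
    calc Real.Gamma (x + 1 / 2) ^ 2 ≤ √(Real.Gamma x * (x * Real.Gamma x)) ^ 2 := by
          have := Real.Gamma_pos_of_pos (show 0 < x + 1 / 2 by linarith)
          gcongr
      _ = _ := by rw [Real.sq_sqrt (by positivity)]; ring
  -- The weak inequality at `m + 1`, pulled back by the functional equation, becomes strict because
  -- `(m + 1/2)²` exceeds `m (m + 1)` by `1/4`.
  have h1 := key (m + 1) (by linarith)
  rw [show m + 1 + 1 / 2 = (m + 1 / 2) + 1 by ring, Real.Gamma_add_one (by positivity),
    Real.Gamma_add_one hm.ne', mul_pow] at h1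
  have hG := Real.Gamma_pos_of_pos hm
  have h3 : 0 < m / 4 * Real.Gamma m ^ 2 := by positivity
  have h4 : 0 ≤ (m + 1 / 2) ^ 2 := by positivity
  refine lt_of_mul_lt_mul_left (h1.trans_lt ?_) h4
  linarith [show (m + 1 / 2) ^ 2 * (m * Real.Gamma m ^ 2) = (m + 1) * (m * Real.Gamma m) ^ 2 +
    m / 4 * Real.Gamma m ^ 2 by ring]

/-! ### Distribution functions of Gamma laws -/

lemma gammaMeasure_real_Iio {κ ζ x : ℝ} (hκ : 0 < κ) (hζ : 0 < ζ) (hx : 0 ≤ x) :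
    (gammaMeasure κ (1 / ζ)).real (Set.Iio x) = 1 / Real.Gamma κ * lowerGamma κ (x / ζ) := by
  have hr : 0 < 1 / ζ := by positivity
  have hprob := isProbabilityMeasure_gammaMeasure hκ hr
  have h1 := integral_gammaMeasure hκ hr ((Set.Iio x).indicator 1)
  rw [integral_indicator_one measurableSet_Iio] at h1
  have h2 := intervalIntegral.integral_comp_mul_left (a := 0) (b := x)
    (fun t => t ^ (κ - 1) * Real.exp (-t)) hr.ne'
  rw [mul_zero, intervalIntegral.integral_of_le hx,
    intervalIntegral.integral_of_le (by positivity), one_div_mul_eq_div] at h2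
  rw [h1, lowerGamma, ← mul_right_inj' (inv_ne_zero hr.ne'), mul_left_comm,
    ← smul_eq_mul (a := (1 / ζ)⁻¹), ← smul_eq_mul (a := (1 / ζ)⁻¹), ← h2, smul_eq_mul, ← integral_const_mul, ← integral_const_mul,
    integral_Ioc_eq_integral_Ioo, ← integral_indicator measurableSet_Ioi,
    ← integral_indicator measurableSet_Ioo]
  congr 1
  ext t
  by_cases ht : 0 < t
  · rw [Set.indicator_of_mem (Set.mem_Ioi.2 ht)]
    by_cases htx : t < x
    · rw [Set.indicator_of_mem (Set.mem_Iio.2 htx), Set.indicator_of_mem (Set.mem_Ioo.2 ⟨ht, htx⟩),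
        Real.mul_rpow hr.le ht.le, Real.rpow_sub hr, Real.rpow_one]
      simp only [Pi.one_apply]
      field_simp
    · rw [Set.indicator_of_notMem (s := Set.Iio x) htx,
        Set.indicator_of_notMem (fun h => htx h.2)]
      simp
  · rw [Set.indicator_of_notMem (s := Set.Ioi 0) ht, Set.indicator_of_notMem (fun h => ht h.1)]

/-- The Erlang sum has a telescoping derivative: only the top term `t^n e^(-t) / n!` survives, so
minus the sum is an antiderivative of the integrand. -/
lemma lowerGamma_natCast {k : ℕ} (hk : 0 < k) {x : ℝ} (hx : 0 ≤ x) :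
    1 / Real.Gamma k * lowerGamma k x =
      1 - ∑ p ∈ Finset.range k, x ^ p / p.factorial * Real.exp (-x) := by
  obtain ⟨n, rfl⟩ : ∃ n, k = n + 1 := ⟨k - 1, by omega⟩
  have hd : ∀ t : ℝ, HasDerivAt
      (fun t : ℝ => -∑ p ∈ Finset.range (n + 1), t ^ p / p.factorial * Real.exp (-t))
      (1 / n.factorial * (t ^ n * Real.exp (-t))) t := by
    intro t
    have he : HasDerivAt (fun t : ℝ => Real.exp (-t)) (-Real.exp (-t)) t := by
      simpa using (hasDerivAt_neg t).exp
    clear hk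
    induction n with
    | zero =>
      refine (he.neg.congr_deriv (by simp)).congr_of_eventuallyEq
        (Filter.Eventually.of_forall fun s => ?_)
      simp
    | succ n ih =>
      have h := ih.sub (((hasDerivAt_pow (n + 1) t).div_const ((n + 1).factorial : ℝ)).mul he)
      refine (h.congr_deriv ?_).congr_of_eventuallyEq (Filter.Eventually.of_forall fun s => ?_)
      · have := n.factorial_pos
        rw [Nat.factorial_succ]
        push_cast
        field_simp
        simp
      · simp only [Finset.sum_range_succ, Pi.sub_apply, Pi.mul_apply]
        ring
  have h := intervalIntegral.integral_eq_sub_of_hasDerivAt (a := 0) (b := x) (fun t _ => hd t)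
    (by apply Continuous.intervalIntegrable; fun_prop)
  rw [intervalIntegral.integral_of_le hx, integral_const_mul] at h
  rw [lowerGamma, Nat.cast_succ, Real.Gamma_nat_eq_factorial]
  simp only [add_sub_cancel_right, Real.rpow_natCast]
  rw [h]
  -- At the lower endpoint only `p = 0` contributes, through `0 ^ 0 = 1`.
  have h0 : ∑ p ∈ Finset.range (n + 1), (0 : ℝ) ^ p / p.factorial * Real.exp (-0) = 1 := by
    rw [Finset.sum_eq_single 0] <;> simp +contextual
  rw [h0]
  ring

/-- The moment of order `p / 2` of a Gamma variable, tilted by `exp (-c √y)`. -/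
lemma integral_gamma_mul_pow_sqrt_mul_exp {a b c : ℝ} (ha : 0 < a) (hb : 0 < b) (hc : 0 < c)
    (p : ℕ) :
    ∫ y in Set.Ioi 0, b ^ a * (y ^ (a - 1) / Real.Gamma a) * Real.exp (-b * y) *
        ((c * √y) ^ p / p.factorial * Real.exp (-(c * √y))) =
      1 / (p.factorial * √Real.pi) * b ^ (-(p : ℝ) / 2) * c ^ p * (1 / Real.Gamma a) *
        (√Real.pi * ∫ u in Set.Ioi 0, u ^ (a + p / 2 - 1) * Real.exp (-u) *
          Real.exp (-(2 * √(c ^ 2 / (4 * b) * u)))) := by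
  -- Under `u = b y`, the constant `c² / (4b)` is the one for which `2√(c² u / (4b))` equals `c √y`.
  have h := integral_comp_mul_left_Ioi (fun u => u ^ (a + p / 2 - 1) * Real.exp (-u) *
    Real.exp (-(2 * √(c ^ 2 / (4 * b) * u)))) 0 hb
  rw [mul_zero, smul_eq_mul, eq_comm, inv_mul_eq_iff_eq_mul₀ hb.ne'] at h
  rw [h, ← integral_const_mul, ← integral_const_mul, ← integral_const_mul]
  refine setIntegral_congr_fun measurableSet_Ioi fun y (hy : 0 < y) => ?_
  have e1 : 2 * √(c ^ 2 / (4 * b) * (b * y)) = c * √y := by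
    rw [show c ^ 2 / (4 * b) * (b * y) = (c / 2) ^ 2 * y by field_simp; ring,
      Real.sqrt_mul (sq_nonneg _), Real.sqrt_sq (by positivity)]
    ring
  have e2 : (b * y) ^ (a + p / 2 - 1) = b ^ a * b ^ ((p : ℝ) / 2) / b * (y ^ (a - 1) * √y ^ p) := by
    rw [Real.mul_rpow hb.le hy.le, Real.rpow_sub hb, Real.rpow_add hb, Real.rpow_one,
      show a + (p : ℝ) / 2 - 1 = (a - 1) + (1 / 2) * p by ring, Real.rpow_add hy, Real.rpow_mul hy.le,
      Real.rpow_natCast, Real.sqrt_eq_rpow]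
  rw [e1, e2, neg_div, Real.rpow_neg hb.le, mul_pow, neg_mul]
  have := Real.Gamma_pos_of_pos ha
  have := Real.rpow_pos_of_pos hb ((p : ℝ) / 2)
  have := Real.sqrt_pos.2 Real.pi_pos
  field_simp

/-! ### Positivity of the link parameters -/

namespace RISParams

variable {S : RISParams}

lemma Valid.ψ_pos (hS : S.Valid) : 0 < S.ψ := by
  obtain ⟨h1, h2, h3, h4, h5, h6, h7, h8, h9, h10⟩ := hS
  unfold ψ ρ; positivity

lemma Valid.lam_pos (hS : S.Valid) : 0 < S.lam := by
  obtain ⟨h1, h2, h3, h4, h5, h6, h7, h8, h9, h10⟩ := hS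
  unfold lam; positivity

lemma Valid.gammaRatio_pos (hS : S.Valid) : 0 < S.gammaRatio := by
  obtain ⟨h1, h2, h3, h4, h5, h6, h7, h8, h9, h10⟩ := hS
  have := Real.Gamma_pos_of_pos h2
  have := Real.Gamma_pos_of_pos h4
  have := Real.Gamma_pos_of_pos (show 0 < S.mb + 1 / 2 by positivity)
  have := Real.Gamma_pos_of_pos (show 0 < S.md + 1 / 2 by positivity)
  unfold gammaRatio; positivity

lemma Valid.μD_pos (hS : S.Valid) : 0 < S.μD := by
  have := hS.gammaRatio_pos
  obtain ⟨h1, h2, h3, h4, h5, h6, h7, h8, h9, h10⟩ := hS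
  unfold μD; positivity

lemma Valid.varD_pos (hS : S.Valid) : 0 < S.varD := by
  obtain ⟨h1, h2, h3, h4, h5, h6, h7, h8, h9, h10⟩ := hS
  have hb := Real.Gamma_pos_of_pos h2
  have hd := Real.Gamma_pos_of_pos h4
  have hlt := mul_lt_mul'' (Gamma_add_half_sq_lt h2) (Gamma_add_half_sq_lt h4) (sq_nonneg _)
    (sq_nonneg _)
  have : 1 / (S.mb * S.md) * S.gammaRatio ^ 2 < 1 := by
    rw [gammaRatio, div_pow, one_div_mul_eq_div, div_div, div_lt_one (by positivity)]
    calc _ = Real.Gamma (S.mb + 1 / 2) ^ 2 * Real.Gamma (S.md + 1 / 2) ^ 2 := by ring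
      _ < _ := hlt
      _ = _ := by ring
  have : 0 < 1 - 1 / (S.mb * S.md) * S.gammaRatio ^ 2 := by linarith
  unfold varD; positivity

lemma Valid.δ_pos (hS : S.Valid) : 0 < S.δ := div_pos (pow_pos hS.μD_pos 2) hS.varD_pos

lemma Valid.ζ_pos (hS : S.Valid) : 0 < S.ζ := div_pos hS.varD_pos hS.μD_pos

lemma fY_mul (S : RISParams) (y f : ℝ) :
    S.fY y * f = (S.md / S.wd) ^ (S.md * S.N) / Real.Gamma (S.md * S.N) *
      y ^ (S.md * S.N - 1) * Real.exp (-(S.md / S.wd * y)) * f := by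
  rw [fY, neg_mul]
  ring

/-! ### Laws of the two branches in the approximate model -/

section Model

variable {Ω : Type*} [MeasurableSpace Ω] {P : Measure Ω} {D Y : Ω → ℝ}

lemma measurable_branch₁ : Measurable fun q : ℝ × ℝ => S.branch₁ q.1 q.2 := by
  unfold branch₁; fun_prop

lemma measurable_branch₂ : Measurable S.branch₂ := by
  unfold branch₂; fun_prop

lemma branchLaw₂_real_Iio (hS : S.Valid) (hδ : matchedShape P D = S.δ) (hζ : matchedScale P D = S.ζ)
    (υ : ℝ) :
    (S.branchLaw₂ P D).real (Set.Iio υ) =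
      1 / Real.Gamma S.δ * lowerGamma S.δ (1 / S.ζ * √(υ / S.ψ)) := by
  have hψ := hS.ψ_pos
  rw [branchLaw₂, hδ, hζ, map_measureReal_apply measurable_branch₂ measurableSet_Iio,
    one_div_mul_eq_div S.ζ, ← gammaMeasure_real_Iio hS.δ_pos hS.ζ_pos (Real.sqrt_nonneg _)]
  refine measureReal_congr ?_
  filter_upwards [ae_pos_gammaMeasure S.δ (1 / S.ζ)] with d hd
  refine propext ?_
  change S.ρ * S.α * d ^ 2 < υ ↔ d < √(υ / S.ψ)
  rw [Real.lt_sqrt hd.le, lt_div_iff₀ hψ, mul_comm, ψ]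

lemma isProbabilityMeasure_branchLaw₂ (hS : S.Valid) (hδ : matchedShape P D = S.δ)
    (hζ : matchedScale P D = S.ζ) : IsProbabilityMeasure (S.branchLaw₂ P D) := by
  have := isProbabilityMeasure_gammaMeasure hS.δ_pos (one_div_pos.2 hS.ζ_pos)
  rw [branchLaw₂, hδ, hζ]
  exact Measure.isProbabilityMeasure_map measurable_branch₂.aemeasurable

lemma isProbabilityMeasure_branchLaw₁ (hS : S.Valid) (hζ : matchedScale P D = S.ζ)
    (hY : HasLaw Y (gammaMeasure (S.md * S.N) (S.md / S.wd)) P) {κ : ℝ} (hκ : 0 < κ) :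
    IsProbabilityMeasure (S.branchLaw₁ P D Y κ) := by
  have := isProbabilityMeasure_gammaMeasure hκ (one_div_pos.2 hS.ζ_pos)
  obtain ⟨h1, h2, h3, h4, h5, -⟩ := hS
  have := isProbabilityMeasure_gammaMeasure (a := S.md * S.N) (by positivity) (div_pos h4 h5)
  rw [branchLaw₁, hζ, hY.map_eq]
  exact Measure.isProbabilityMeasure_map measurable_branch₁.aemeasurable

/-- Given `Y = y > 0`, the event is almost surely that the Gamma variable lies below `√(λυy/ψ)`;
Fubini averages over `y`. The conditional probability is at most one, hence integrable. -/
lemma branchLaw₁_real_Iio (hS : S.Valid) (hζ : matchedScale P D = S.ζ)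
    (hY : HasLaw Y (gammaMeasure (S.md * S.N) (S.md / S.wd)) P) {κ : ℝ} (hκ : 0 < κ) {υ : ℝ} :
    IntegrableOn (fun y => S.fY y *
      (1 / Real.Gamma κ * lowerGamma κ (√(S.lam * υ * y / S.ψ) / S.ζ))) (Set.Ioi 0) ∧
    (S.branchLaw₁ P D Y κ).real (Set.Iio υ) = ∫ y in Set.Ioi 0, S.fY y *
      (1 / Real.Gamma κ * lowerGamma κ (√(S.lam * υ * y / S.ψ) / S.ζ)) := by
  have hψ := hS.ψ_pos
  have hlam := hS.lam_pos
  have hζ0 := hS.ζ_pos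
  have hX := isProbabilityMeasure_gammaMeasure hκ (one_div_pos.2 hζ0)
  obtain ⟨h1, h2, h3, h4, h5, -⟩ := hS
  have ha : 0 < S.md * S.N := by positivity
  have hb := div_pos h4 h5
  have hYp := isProbabilityMeasure_gammaMeasure ha hb
  set ν := gammaMeasure (S.md * S.N) (S.md / S.wd)
  set η := gammaMeasure κ (1 / S.ζ)
  have hm : MeasurableSet ((fun q : ℝ × ℝ => S.branch₁ q.1 q.2) ⁻¹' Set.Iio υ) :=
    measurable_branch₁ measurableSet_Iio
  have hsec : ∀ y, 0 < y → η.real ((fun x => (x, y)) ⁻¹'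
      ((fun q : ℝ × ℝ => S.branch₁ q.1 q.2) ⁻¹' Set.Iio υ)) =
      1 / Real.Gamma κ * lowerGamma κ (√(S.lam * υ * y / S.ψ) / S.ζ) := by
    intro y hy
    rw [← gammaMeasure_real_Iio hκ hζ0 (Real.sqrt_nonneg _)]
    refine measureReal_congr ?_
    filter_upwards [ae_pos_gammaMeasure κ (1 / S.ζ)] with d hd
    refine propext ?_
    change S.ρ * S.α * d ^ 2 / (y * S.lam) < υ ↔ d < √(S.lam * υ * y / S.ψ)
    rw [Real.lt_sqrt hd.le, lt_div_iff₀ hψ, div_lt_iff₀ (by positivity), mul_comm (d ^ 2),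
      show υ * (y * S.lam) = S.lam * υ * y by ring, ψ]
  have hmeas : Measurable fun y => η.real ((fun x => (x, y)) ⁻¹'
      ((fun q : ℝ × ℝ => S.branch₁ q.1 q.2) ⁻¹' Set.Iio υ)) :=
    (measurable_measure_prodMk_right hm).ennreal_toReal
  have hae : (fun y => η.real ((fun x => (x, y)) ⁻¹'
      ((fun q : ℝ × ℝ => S.branch₁ q.1 q.2) ⁻¹' Set.Iio υ))) =ᵐ[ν]
      fun y => 1 / Real.Gamma κ * lowerGamma κ (√(S.lam * υ * y / S.ψ) / S.ζ) := by
    filter_upwards [ae_pos_gammaMeasure (S.md * S.N) (S.md / S.wd)] with y hy using hsec y hy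
  constructor
  · simp_rw [fY_mul]
    refine (integrable_gammaMeasure_iff ha hb _).1 (Integrable.congr ?_ hae)
    refine Integrable.of_bound hmeas.aestronglyMeasurable 1 (ae_of_all _ fun y => ?_)
    rw [Real.norm_of_nonneg measureReal_nonneg]
    exact measureReal_le_one
  · simp_rw [fY_mul]
    rw [← integral_gammaMeasure ha hb, ← integral_congr_ae hae, branchLaw₁, hζ, hY.map_eq,
      map_measureReal_apply measurable_branch₁ measurableSet_Iio, measureReal_def,
      Measure.prod_apply_symm hm]
    exact (integral_toReal (measurable_measure_prodMk_right hm).aemeasurable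
      (ae_of_all _ fun y => measure_lt_top _ _)).symm

lemma coe_branchLaw₂_eq_ξ₂ (hS : S.Valid) (hδ : matchedShape P D = S.δ)
    (hζ : matchedScale P D = S.ζ) {υ : ℝ} (hυ : 0 < υ) :
    MeijerGWellDefined 1 1 ![1] ![(S.δ : ℂ), 0] (S.arg₂ υ) ∧
      (((S.branchLaw₂ P D).real (Set.Iio υ) : ℝ) : ℂ) = S.ξ₂ υ := by
  have hψ := hS.ψ_pos
  have hζ0 := hS.ζ_pos
  have h := meijerG_one_one_one_two hS.δ_pos (z := 1 / S.ζ * √(υ / S.ψ)) (by positivity)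
  refine ⟨h.1, ?_⟩
  rw [branchLaw₂_real_Iio hS hδ hζ, ξ₂, arg₂, h.2, Complex.ofReal_mul]

/-- Integer shape makes the conditional probability an Erlang sum in `c √y`. The factor `(√y)^p`
raises the exponent of the density of `Y` by `p/2`, whence `A = m_d N + p/2`. -/
lemma coe_branchLaw₁_eq_ξ₁ (hS : S.Valid) (hζ : matchedScale P D = S.ζ)
    (hY : HasLaw Y (gammaMeasure (S.md * S.N) (S.md / S.wd)) P) {k : ℕ} (hk : 0 < k) {υ : ℝ}
    (hυ : 0 < υ) :
    (∀ p < k, MeijerGWellDefined 2 1 (S.topParam₁ p) ![0, 1 / 2] (S.arg₁ υ)) ∧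
      (((S.branchLaw₁ P D Y k).real (Set.Iio υ) : ℝ) : ℂ) = S.ξ₁ k υ := by
  have hψ := hS.ψ_pos
  have hlam := hS.lam_pos
  have hζ0 := hS.ζ_pos
  have hlaw := branchLaw₁_real_Iio hS hζ hY (κ := k) (by exact_mod_cast hk) (υ := υ)
  obtain ⟨h1, h2, h3, h4, h5, -⟩ := hS
  have ha : 0 < S.md * S.N := by positivity
  have hb := div_pos h4 h5
  have hYp := isProbabilityMeasure_gammaMeasure ha hb
  have hM : ∀ p : ℕ, _ := fun p => meijerG_two_one_one_two (A := S.md * S.N + p / 2)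
    (z := S.lam * S.wd * υ / (4 * S.ψ * S.md * S.ζ ^ 2)) (by positivity) (by positivity)
  have hA : ∀ p : ℕ, S.topParam₁ p = ![((1 - (S.md * S.N + p / 2) : ℝ) : ℂ)] := fun p => by
    rw [topParam₁, sub_sub]
  refine ⟨fun p _ => by rw [hA]; exact (hM p).1, ?_⟩
  set c := 1 / S.ζ * √(υ * S.lam / S.ψ) with hc
  have hc0 : 0 < c := by positivity
  have hx : ∀ y, 0 < y → √(S.lam * υ * y / S.ψ) / S.ζ = c * √y := by
    intro y hy
    rw [hc, show S.lam * υ * y / S.ψ = υ * S.lam / S.ψ * y by ring, Real.sqrt_mul (by positivity)]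
    ring
  have hz : c ^ 2 / (4 * (S.md / S.wd)) = S.lam * S.wd * υ / (4 * S.ψ * S.md * S.ζ ^ 2) := by
    rw [hc, mul_pow, Real.sq_sqrt (by positivity)]
    field_simp
  have hone : IntegrableOn S.fY (Set.Ioi 0) ∧ ∫ y in Set.Ioi 0, S.fY y = 1 := by
    have e : S.fY = fun y => (S.md / S.wd) ^ (S.md * S.N) / Real.Gamma (S.md * S.N) *
      y ^ (S.md * S.N - 1) * Real.exp (-(S.md / S.wd * y)) * (fun _ => (1 : ℝ)) y := by
      ext y
      rw [← fY_mul, mul_one]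
    rw [e, ← integrable_gammaMeasure_iff ha hb, ← integral_gammaMeasure ha hb]
    exact ⟨integrable_const _, by simp⟩
  have hint : ∀ p : ℕ, IntegrableOn (fun y => S.fY y *
      ((c * √y) ^ p / p.factorial * Real.exp (-(c * √y)))) (Set.Ioi 0) := by
    intro p
    -- Each Erlang term is at most one, since `x^p / p! ≤ e^x`.
    refine hone.1.mul_bdd (c := 1) (by fun_prop) (ae_of_all _ fun y => ?_)
    have h0 : 0 ≤ c * √y := by positivity
    rw [Real.norm_of_nonneg (by positivity), Real.exp_neg, ← div_eq_mul_inv,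
      div_le_one (Real.exp_pos _)]
    exact Real.pow_div_factorial_le_exp _ h0 _
  have hreal : (S.branchLaw₁ P D Y k).real (Set.Iio υ) = 1 - ∑ p ∈ Finset.range k,
      ∫ y in Set.Ioi 0, S.fY y * ((c * √y) ^ p / p.factorial * Real.exp (-(c * √y))) := by
    rw [hlaw.2, ← integral_finsetSum _ fun p _ => hint p]
    -- The leading `1` is written as the total mass of `fY`, so that both sides become integrals.
    refine Eq.trans ?_ (congrArg (· - _) hone.2)
    rw [← integral_sub hone.1 (integrable_finsetSum _ fun p _ => hint p)]
    refine setIntegral_congr_fun measurableSet_Ioi fun y (hy : 0 < y) => ?_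
    rw [hx y hy, lowerGamma_natCast hk (by positivity), mul_sub, mul_one, Finset.mul_sum]
  rw [hreal, ξ₁, Complex.ofReal_sub, Complex.ofReal_one, Complex.ofReal_sum]
  congr 1
  refine Finset.sum_congr rfl fun p _ => ?_
  rw [hA, arg₁, (hM p).2, ← Complex.ofReal_mul, ← hz, ← integral_gamma_mul_pow_sqrt_mul_exp ha hb hc0]
  rfl

end Model

end RISParams

/-- The minimum of two independent variables. -/
lemma prod_real_min_lt (μ ν : Measure ℝ) [IsProbabilityMeasure μ] [IsProbabilityMeasure ν] (υ : ℝ) :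
    (μ.prod ν).real {q | min q.1 q.2 < υ} =
      1 - (1 - μ.real (Set.Iio υ)) * (1 - ν.real (Set.Iio υ)) := by
  -- The complement, where both coordinates are at least `υ`, is a rectangle.
  have h : {q : ℝ × ℝ | min q.1 q.2 < υ} = ((Set.Iio υ)ᶜ ×ˢ (Set.Iio υ)ᶜ)ᶜ := by
    ext q
    simp only [Set.mem_ofPred_eq, min_lt_iff, Set.mem_compl_iff, Set.mem_prod, Set.mem_Iio]
    tauto
  rw [h, probReal_compl_eq_one_sub (measurableSet_Iio.compl.prod measurableSet_Iio.compl),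
    measureReal_prod_prod, probReal_compl_eq_one_sub measurableSet_Iio,
    probReal_compl_eq_one_sub measurableSet_Iio]

namespace RISParams

variable {S : RISParams}

/-! ### Deterministic bounds -/

lemma signalAmp_eq_of_aligned {gb gd : Fin S.N → ℂ} {φ : Fin S.N → ℝ} (h : S.Aligned gb gd φ) :
    S.signalAmp gb gd φ = ∑ n, ‖gd n‖ * ‖gb n‖ := by
  obtain ⟨θ, hθ⟩ := h
  have e : dotProduct (Matrix.vecMul (star gd) (S.reflection φ)) gb =
      ((∑ n, ‖gd n‖ * ‖gb n‖ : ℝ) : ℂ) * Complex.exp ((θ : ℂ) * Complex.I) := by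
    rw [dotProduct, Complex.ofReal_sum, Finset.sum_mul]
    refine Finset.sum_congr rfl fun n _ => ?_
    rw [← hθ n, reflection, Matrix.vecMul_diagonal, Pi.star_apply]
  rw [signalAmp, e, norm_mul, Complex.norm_exp_ofReal_mul_I, mul_one, Complex.norm_real,
    Real.norm_of_nonneg (Finset.sum_nonneg fun n _ => by positivity)]

lemma noiseGain_eq (gd : Fin S.N → ℂ) (φ : Fin S.N → ℝ) : S.noiseGain gd φ = ∑ n, ‖gd n‖ ^ 2 := by
  refine Finset.sum_congr rfl fun n _ => ?_
  rw [reflection, Matrix.vecMul_diagonal, Pi.star_apply, norm_mul, norm_star,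
    Complex.norm_exp_ofReal_mul_I, mul_one]

lemma sinrLB_le_sinr_le_sinrUB (hS : S.Valid) {gb gd : Fin S.N → ℂ} {φ : Fin S.N → ℝ}
    (h : S.Aligned gb gd φ) :
    S.sinrLB gb gd φ ≤ S.sinr gb gd φ ∧ S.sinr gb gd φ ≤ S.sinrUB gb gd φ := by
  have hψ : 0 < S.ρ * S.α := hS.ψ_pos
  have hlam := hS.lam_pos
  -- Zero noise gain forces `gd = 0` and hence zero amplitude. All terms then vanish, and `0 / 0 =
  -- 0` agrees with the convention for the first branch.
  have hzero : S.noiseGain gd φ = 0 → S.signalAmp gb gd φ = 0 := by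
    intro h0
    rw [noiseGain_eq, Finset.sum_eq_zero_iff_of_nonneg (fun n _ => by positivity)] at h0
    rw [signalAmp_eq_of_aligned h]
    refine Finset.sum_eq_zero fun n hn => ?_
    rw [pow_eq_zero_iff two_ne_zero |>.1 (h0 n hn), zero_mul]
  have hy0 : 0 ≤ S.noiseGain gd φ := by rw [noiseGain_eq]; positivity
  simp only [sinrLB, sinr, sinrUB, branch₁, branch₂]
  set d := S.signalAmp gb gd φ
  set y := S.noiseGain gd φ
  rcases hy0.eq_or_lt with hy | hy
  · rw [hzero hy.symm]
    simp
  · have hx : 0 < y * S.lam := by positivity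
    have hd : 0 ≤ S.ρ * S.α * d ^ 2 := by positivity
    set x := y * S.lam
    set w := S.ρ * S.α * d ^ 2
    constructor
    -- The smaller branch is `w / max 1 x`, and `x + 1` is at most twice that maximum.
    · rcases le_total x 1 with h1 | h1
      · calc 1 / 2 * min (w / x) w ≤ 1 / 2 * w := by gcongr; exact min_le_right _ _
          _ = w / 2 := by ring
          _ ≤ w / (x + 1) := by gcongr; linarith
      · calc 1 / 2 * min (w / x) w ≤ 1 / 2 * (w / x) := by gcongr; exact min_le_left _ _
          _ = w / (2 * x) := by ring
          _ ≤ w / (x + 1) := by gcongr; linarith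
    · refine le_min ?_ ?_
      · gcongr; linarith
      · exact div_le_self hd (by linarith)

end RISParams

/-! ### The cascaded amplitude -/

section Cascade

variable {Ω : Type*} [MeasurableSpace Ω] {P : Measure Ω}

lemma moments_mul_of_nakagami {X Z : Ω → ℝ} {m w m' w' : ℝ} (hm : 0 < m) (hw : 0 < w)
    (hm' : 0 < m') (hw' : 0 < w') (hX : HasLaw X (nakagamiMeasure m w) P)
    (hZ : HasLaw Z (nakagamiMeasure m' w') P) (hX0 : ∀ ω, 0 ≤ X ω) (hZ0 : ∀ ω, 0 ≤ Z ω)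
    (hind : IndepFun X Z P) :
    MemLp (fun ω => X ω * Z ω) 2 P ∧
      ∫ ω, X ω * Z ω ∂P = Real.Gamma (m + 1 / 2) / Real.Gamma m * (w / m) ^ (1 / 2 : ℝ) *
        (Real.Gamma (m' + 1 / 2) / Real.Gamma m' * (w' / m') ^ (1 / 2 : ℝ)) ∧
      ∫ ω, (X ω * Z ω) ^ 2 ∂P = w * w' := by
  have hXm := hX.aemeasurable.aestronglyMeasurable
  have hZm := hZ.aemeasurable.aestronglyMeasurable
  have hX2 := memLp_two_of_nakagami hm hw hX
  have hZ2 := memLp_two_of_nakagami hm' hw' hZ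
  have hsq : IndepFun (fun ω => X ω ^ 2) (fun ω => Z ω ^ 2) P :=
    hind.comp (φ := fun x => x ^ 2) (ψ := fun x => x ^ 2) (by fun_prop) (by fun_prop)
  refine ⟨?_, ?_, ?_⟩
  · have hXZ : AEStronglyMeasurable (fun ω => X ω * Z ω) P := hXm.mul hZm
    rw [memLp_two_iff_integrable_sq hXZ]
    simp_rw [mul_pow]
    exact hsq.integrable_mul hX2.integrable_sq hZ2.integrable_sq
  · rw [← integral_of_nakagami hm hw hX hX0, ← integral_of_nakagami hm' hw' hZ hZ0]
    exact hind.integral_mul_eq_mul_integral hXm hZm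
  · simp_rw [mul_pow]
    rw [← integral_sq_of_nakagami hm hw hX, ← integral_sq_of_nakagami hm' hw' hZ]
    exact hsq.integral_mul_eq_mul_integral hX2.integrable_sq.1 hZ2.integrable_sq.1

lemma RISParams.moments_amplitude [IsProbabilityMeasure P] {S : RISParams} (hS : S.Valid) {gb gd : Fin S.N → Ω → ℂ}
    (hgb : ∀ n, Measurable (gb n)) (hgd : ∀ n, Measurable (gd n))
    (hindep : iIndepFun (Sum.elim gb gd) P)
    (hgb_law : ∀ n, HasLaw (fun ω => ‖gb n ω‖) (nakagamiMeasure S.mb S.wb) P)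
    (hgd_law : ∀ n, HasLaw (fun ω => ‖gd n ω‖) (nakagamiMeasure S.md S.wd) P) :
    MemLp (fun ω => ∑ n, ‖gd n ω‖ * ‖gb n ω‖) 2 P ∧
      ∫ ω, ∑ n, ‖gd n ω‖ * ‖gb n ω‖ ∂P = S.μD ∧
      variance (fun ω => ∑ n, ‖gd n ω‖ * ‖gb n ω‖) P = S.varD := by
  obtain ⟨h1, h2, h3, h4, h5, -⟩ := hS
  have hmeas : ∀ j, Measurable (Sum.elim gb gd j) := by rintro (n | n); exacts [hgb n, hgd n]
  have hmom := fun n => moments_mul_of_nakagami h4 h5 h2 h3 (hgd_law n) (hgb_law n)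
    (fun ω => norm_nonneg _) (fun ω => norm_nonneg _)
    ((hindep.indepFun (i := Sum.inr n) (j := Sum.inl n) (by simp)).comp measurable_norm
      measurable_norm)
  have hG := Real.Gamma_pos_of_pos h2
  have hG' := Real.Gamma_pos_of_pos h4
  have hsplit : (S.wb * S.wd / (S.mb * S.md)) ^ (1 / 2 : ℝ) =
      (S.wd / S.md) ^ (1 / 2 : ℝ) * (S.wb / S.mb) ^ (1 / 2 : ℝ) := by
    rw [← Real.mul_rpow (by positivity) (by positivity)]
    congr 1
    field_simp
  refine ⟨memLp_finsetSum _ fun n _ => (hmom n).1, ?_, ?_⟩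
  · rw [integral_finsetSum _ fun n _ => (hmom n).1.integrable one_le_two]
    simp_rw [fun n => (hmom n).2.1]
    rw [Finset.sum_const, Finset.card_univ, Fintype.card_fin, nsmul_eq_mul, μD, gammaRatio, hsplit]
    field_simp
  -- Products with different indices involve disjoint pairs of channel entries, so the variances
  -- add.
  · have hpair : Set.Pairwise ((Finset.univ : Finset (Fin S.N)) : Set (Fin S.N)) fun i j =>
        IndepFun (fun ω => ‖gd i ω‖ * ‖gb i ω‖) (fun ω => ‖gd j ω‖ * ‖gb j ω‖) P := by
      intro i _ j _ hij
      exact (hindep.indepFun_prodMk_prodMk hmeas (Sum.inr i) (Sum.inl i) (Sum.inr j) (Sum.inl j)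
        (by simpa using hij) (by simp) (by simp) (by simpa using hij)).comp
        (φ := fun q : ℂ × ℂ => ‖q.1‖ * ‖q.2‖) (ψ := fun q : ℂ × ℂ => ‖q.1‖ * ‖q.2‖)
        (by fun_prop) (by fun_prop)
    have hv := IndepFun.variance_sum (fun n _ => (hmom n).1) hpair
    have hfun : (∑ n, fun ω => ‖gd n ω‖ * ‖gb n ω‖) = fun ω => ∑ n, ‖gd n ω‖ * ‖gb n ω‖ := by
      ext ω; simp
    rw [hfun] at hv
    have hvn : ∀ n, variance (fun ω => ‖gd n ω‖ * ‖gb n ω‖) P =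
        S.wb * S.wd * (1 - 1 / (S.mb * S.md) * S.gammaRatio ^ 2) := by
      intro n
      rw [variance_eq_sub (hmom n).1, (hmom n).2.1]
      have := (hmom n).2.2
      simp only [Pi.pow_apply]
      have hs1 : ((S.wd / S.md) ^ (1 / 2 : ℝ)) ^ 2 = S.wd / S.md := by
        rw [← Real.sqrt_eq_rpow, Real.sq_sqrt (by positivity)]
      have hs2 : ((S.wb / S.mb) ^ (1 / 2 : ℝ)) ^ 2 = S.wb / S.mb := by
        rw [← Real.sqrt_eq_rpow, Real.sq_sqrt (by positivity)]
      rw [this, mul_pow, mul_pow, mul_pow, hs1, hs2, gammaRatio]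
      field_simp
    rw [hv]
    simp_rw [hvn]
    rw [Finset.sum_const, Finset.card_univ, Fintype.card_fin, nsmul_eq_mul, varD]
    ring

end Cascade

/-! ### Assembly of the outage formulas -/

theorem proposition1 {Ω : Type*} [MeasurableSpace Ω] (P : Measure Ω) [IsProbabilityMeasure P]
    (S : RISParams) (hS : S.Valid)
    (R B : ℝ) (hR : 0 < R) (hB : 0 < B) (Υ : ℝ) (hΥ : Υ = sinrThreshold R B)
    -- the channels, independent, with Nakagami magnitudes
    (gb gd : Fin S.N → Ω → ℂ)
    (hgb : ∀ n, Measurable (gb n)) (hgd : ∀ n, Measurable (gd n))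
    (hindep : iIndepFun (Sum.elim gb gd) P)
    (hgb_law : ∀ n, HasLaw (fun ω => ‖gb n ω‖) (nakagamiMeasure S.mb S.wb) P)
    (hgd_law : ∀ n, HasLaw (fun ω => ‖gd n ω‖) (nakagamiMeasure S.md S.wd) P)
    -- the phase shifts, which may depend on the channels, align all paths
    (φ : Fin S.N → Ω → ℝ) (hφ_range : ∀ n ω, φ n ω ∈ Set.Ioc 0 (2 * Real.pi))
    (hφ : ∀ ω, S.Aligned (fun n => gb n ω) (fun n => gd n ω) (fun n => φ n ω))
    -- the SINR and its bounds, the amplitude and the noise gain, as random variables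
    (γ γUB γLB D Y : Ω → ℝ)
    (hγ : γ = fun ω => S.sinr (fun n => gb n ω) (fun n => gd n ω) (fun n => φ n ω))
    (hγUB : γUB = fun ω => S.sinrUB (fun n => gb n ω) (fun n => gd n ω) (fun n => φ n ω))
    (hγLB : γLB = fun ω => S.sinrLB (fun n => gb n ω) (fun n => gd n ω) (fun n => φ n ω))
    (hD : D = fun ω => S.signalAmp (fun n => gb n ω) (fun n => gd n ω) (fun n => φ n ω))
    (hY : Y = fun ω => S.noiseGain (fun n => gd n ω) (fun n => φ n ω)) :
    -- the bounds of the SINR and of the exact outage probability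
    ((∀ ω, γLB ω ≤ γ ω ∧ γ ω ≤ γUB ω) ∧
      P.real {ω | γUB ω < Υ} ≤ P.real {ω | γ ω < Υ} ∧
      P.real {ω | γ ω < Υ} ≤ P.real {ω | γLB ω < Υ} ∧
      P.real {ω | γLB ω < Υ} = P.real {ω | γUB ω < 2 * Υ}) ∧
    -- the parameters of the approximate model
    (MemLp D 2 P ∧ ∫ ω, D ω ∂P = S.μD ∧ variance D P = S.varD ∧ 0 < S.μD ∧ 0 < S.varD ∧
      matchedShape P D = S.δ ∧ matchedScale P D = S.ζ ∧
      HasLaw Y (gammaMeasure (S.md * S.N) (S.md / S.wd)) P) ∧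
    -- the approximate outage probability with the matched (real) shape
    (∀ υ : ℝ, υ = Υ ∨ υ = 2 * Υ →
      IntegrableOn (fun y => S.fY y * S.FX (S.lam * υ * y / S.ψ)) (Set.Ioi 0) ∧
      (S.branchLaw₁ P D Y S.δ).real (Set.Iio υ) =
        ∫ y in Set.Ioi 0, S.fY y * S.FX (S.lam * υ * y / S.ψ)) ∧
    ((S.approxOutageLB P D Y S.δ Υ : ℝ) : ℂ) =
      1 - (1 - ((∫ y in Set.Ioi 0, S.fY y * S.FX (S.lam * Υ * y / S.ψ) : ℝ) : ℂ)) *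
        (1 - S.ξ₂ Υ) ∧
    ((S.approxOutageUB P D Y S.δ Υ : ℝ) : ℂ) =
      1 - (1 - ((∫ y in Set.Ioi 0, S.fY y * S.FX (S.lam * (2 * Υ) * y / S.ψ) : ℝ) : ℂ)) *
        (1 - S.ξ₂ (2 * Υ)) ∧
    -- the closed form, with a positive integer `k` as the shape in the first branch
    (∀ k : ℕ, 0 < k →
      (∀ υ : ℝ, υ = Υ ∨ υ = 2 * Υ →
        (∀ p < k, MeijerGWellDefined 2 1 (S.topParam₁ p) ![0, 1 / 2] (S.arg₁ υ)) ∧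
        MeijerGWellDefined 1 1 ![1] ![(S.δ : ℂ), 0] (S.arg₂ υ) ∧
        (((S.branchLaw₁ P D Y k).real (Set.Iio υ) : ℝ) : ℂ) = S.ξ₁ k υ ∧
        (((S.branchLaw₂ P D).real (Set.Iio υ) : ℝ) : ℂ) = S.ξ₂ υ) ∧
      ((S.approxOutageLB P D Y k Υ : ℝ) : ℂ) = 1 - (1 - S.ξ₁ k Υ) * (1 - S.ξ₂ Υ) ∧
      ((S.approxOutageUB P D Y k Υ : ℝ) : ℂ) =
        1 - (1 - S.ξ₁ k (2 * Υ)) * (1 - S.ξ₂ (2 * Υ))) := by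
  -- A positive rate makes the threshold positive, which keeps the Meijer arguments positive.
  have hΥ0 : 0 < Υ := by
    rw [hΥ, sinrThreshold, sub_pos]
    exact Real.one_lt_rpow one_lt_two (div_pos hR hB)
  have hυ0 : ∀ υ : ℝ, υ = Υ ∨ υ = 2 * Υ → 0 < υ := by
    rintro υ (rfl | rfl) <;> positivity
  have hDsum : D = fun ω => ∑ n, ‖gd n ω‖ * ‖gb n ω‖ := by
    rw [hD]; ext ω; exact RISParams.signalAmp_eq_of_aligned (hφ ω)
  have hYsum : Y = fun ω => ∑ n, ‖gd n ω‖ ^ 2 := by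
    rw [hY]; ext ω; exact RISParams.noiseGain_eq _ _
  have hbound : ∀ ω, γLB ω ≤ γ ω ∧ γ ω ≤ γUB ω := by
    intro ω
    rw [hγ, hγUB, hγLB]
    exact RISParams.sinrLB_le_sinr_le_sinrUB hS (hφ ω)
  have hhalf : ∀ ω, γLB ω = 1 / 2 * γUB ω := by
    intro ω
    rw [hγLB, hγUB]
    rfl
  obtain ⟨hD2, hDm, hDv⟩ : MemLp D 2 P ∧ ∫ ω, D ω ∂P = S.μD ∧ variance D P = S.varD := by
    rw [hDsum]
    exact RISParams.moments_amplitude hS hgb hgd hindep hgb_law hgd_law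
  have hδ : matchedShape P D = S.δ := by rw [matchedShape, hDm, hDv, RISParams.δ]
  have hζ : matchedScale P D = S.ζ := by rw [matchedScale, hDm, hDv, RISParams.ζ]
  have hYlaw : HasLaw Y (gammaMeasure (S.md * S.N) (S.md / S.wd)) P := by
    obtain ⟨h1, h2, h3, h4, h5, -⟩ := hS
    rw [hYsum]
    refine hasLaw_sum_gammaMeasure h1 h4 (div_pos h4 h5) ?_
      fun n => hasLaw_sq_of_nakagami h4 h5 (hgd_law n)
    -- Only the entries of `gd` enter `Y`, so the joint independence is restricted to the right
    -- summand.
    exact (hindep.precomp Sum.inr_injective).comp (fun _ z => ‖z‖ ^ 2) fun _ => by fun_prop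
  have hprob₂ := RISParams.isProbabilityMeasure_branchLaw₂ hS hδ hζ
  have hLB : ∀ κ : ℝ, 0 < κ → ((S.approxOutageLB P D Y κ Υ : ℝ) : ℂ) =
      1 - (1 - ((S.branchLaw₁ P D Y κ).real (Set.Iio Υ) : ℂ)) * (1 - S.ξ₂ Υ) := by
    intro κ hκ
    have hprob₁ := RISParams.isProbabilityMeasure_branchLaw₁ hS hζ hYlaw hκ
    rw [← (RISParams.coe_branchLaw₂_eq_ξ₂ hS hδ hζ hΥ0).2, RISParams.approxOutageLB,
      prod_real_min_lt]
    push_cast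
    rfl
  have hUB : ∀ κ : ℝ, 0 < κ → ((S.approxOutageUB P D Y κ Υ : ℝ) : ℂ) =
      1 - (1 - ((S.branchLaw₁ P D Y κ).real (Set.Iio (2 * Υ)) : ℂ)) * (1 - S.ξ₂ (2 * Υ)) := by
    intro κ hκ
    have hprob₁ := RISParams.isProbabilityMeasure_branchLaw₁ hS hζ hYlaw hκ
    have hset : {q : ℝ × ℝ | 1 / 2 * min q.1 q.2 < Υ} = {q | min q.1 q.2 < 2 * Υ} := by
      ext q
      simp only [Set.mem_ofPred_eq]
      constructor <;> intro h <;> linarith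
    rw [← (RISParams.coe_branchLaw₂_eq_ξ₂ hS hδ hζ (hυ0 _ (Or.inr rfl))).2,
      RISParams.approxOutageUB, hset, prod_real_min_lt]
    push_cast
    rfl
  have hreal : ∀ υ : ℝ, _ := fun υ =>
    RISParams.branchLaw₁_real_Iio hS hζ hYlaw hS.δ_pos (υ := υ)
  refine ⟨⟨hbound, ?_, ?_, ?_⟩, ⟨hD2, hDm, hDv, hS.μD_pos, hS.varD_pos, hδ, hζ, hYlaw⟩,
    fun υ _ => hreal υ, ?_, ?_, fun k hk => ⟨fun υ hυ => ?_, ?_, ?_⟩⟩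
  · exact measureReal_mono fun ω hω => (hbound ω).2.trans_lt hω
  · exact measureReal_mono fun ω hω => (hbound ω).1.trans_lt hω
  · congr 1
    ext ω
    simp only [Set.mem_ofPred_eq, hhalf]
    constructor <;> intro h <;> linarith
  -- At `κ = δ` the averaged distribution function is `FX` by definition.
  · rw [hLB _ hS.δ_pos, (hreal Υ).2]
    rfl
  · rw [hUB _ hS.δ_pos, (hreal (2 * Υ)).2]
    rfl
  · have hξ₁ := RISParams.coe_branchLaw₁_eq_ξ₁ hS hζ hYlaw hk (hυ0 υ hυ)
    have hξ₂ := RISParams.coe_branchLaw₂_eq_ξ₂ hS hδ hζ (hυ0 υ hυ)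
    exact ⟨hξ₁.1, hξ₂.1, hξ₁.2, hξ₂.2⟩
  · rw [hLB _ (by exact_mod_cast hk),
      (RISParams.coe_branchLaw₁_eq_ξ₁ hS hζ hYlaw hk hΥ0).2]
  · rw [hUB _ (by exact_mod_cast hk),
      (RISParams.coe_branchLaw₁_eq_ξ₁ hS hζ hYlaw hk (hυ0 _ (Or.inr rfl))).2]
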